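/- Let $\Omega\subset\mathbb{R}^3$ be a simply connected bounded domain with smooth boundary and outward unit normal $n$, let $\gamma>1$, $\mu>0$, $2\mu+3\lambda\ge 0$, and consider the compressible isentropic Navier--Stokes equations $$\rho_t+\operatorname{div}(\rho u)=0,\qquad (\rho u)_t+\operatorname{div}(\rho u\otimes u)+\nabla \rho^\gamma=\mu\Delta u+(\mu+\lambda)\nabla\operatorname{div}u$$ in $\Omega\times(0,\infty)$, with initial data $\rho|_{t=0}=\rho_0$, $(\rho u)|_{t=0}=\rho_0u_0$ and slip boundary conditions $u\cdot n=0$, $\operatorname{curl}u\times n=0$ on $\partial\Omega$ for $t>0$ (in the sense of traces). For $T>0$, $(\rho,u)$ is called a strong solution on $\Omega\times[0,T]$ if, for some $q\in(3,6]$, $$0\le\rho\in C([0,T];W^{1,q}(\Omega)),\quad \rho_t\in C([0,T];L^q(\Omega)),\quad u\in C([0,T];H^2(\Omega))\cap L^2(0,T;W^{2,q}(\Omega)),$$ $$\sqrt\rho\,u_t\in L^\infty(0,T;L^2(\Omega)),\quad u_t\in L^2(0,T;H^1(\Omega)),$$ the boundary conditions hold, and the equations hold a.e. in $\Omega\times[0,T]$.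 It is a global strong solution if this is so for every $T>0$ and it attains the initial data. Assume that $\rho_0\ge 0$ and, with $\bar\rho_0=\frac1{|\Omega|}\int_\Omega\rho_0\,dx$, $$\|\rho_0-\bar\rho_0\|_{L^2(\Omega)}+\|\sqrt{\rho_0}\,u_0\|_{L^2(\Omega)}+\|\nabla u_0\|_{H^1(\Omega)}<\infty .$$ Let $(\rho,u)$ be a global strong solution with $\sup_{t\ge0}\|\rho(\cdot,t)\|_{L^\infty(\Omega)}\le\hat\rho$ for some constant $\hat\rho>0$. If the initial density has a vacuum, that is $\inf_{x\in\Omega}\rho_0(x)=0$, then $$\inf_{x\in\Omega}\rho(x,t)=0\qquad\text{for every }t\ge0 .$$ Here the infimum of a function given up to null sets is the essential infimum, i.e. the infimum over $\Omega$ of the continuous representative of $\rho(\cdot,t)\in W^{1,q}(\Omega)$. -/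

import Mathlib

open MeasureTheory Set Filter Topology
open scoped ENNReal ContDiff

noncomputable section

namespace CompressibleNS

/-- Three-dimensional Euclidean space. -/
abbrev E3 : Type := EuclideanSpace ℝ (Fin 3)

/-- The `i`-th standard basis vector of `ℝ³`. -/
def e (i : Fin 3) : E3 := EuclideanSpace.single i 1

/-- `Ω` has a smooth boundary: near each of its boundary points, `Ω` is the strict sublevel set
`{g < 0}` of a smooth function `g` whose derivative does not vanish there. -/
def HasSmoothBoundary (Ω : Set E3) : Prop :=
  ∀ x₀ ∈ frontier Ω, ∃ g : E3 → ℝ, ContDiff ℝ ∞ g ∧ fderiv ℝ g x₀ ≠ 0 ∧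
    ∀ᶠ x in 𝓝 x₀, (x ∈ Ω ↔ g x < 0)

/-- A simply connected smooth bounded domain in `ℝ³` (simple connectedness includes that `Ω` is
nonempty and path connected). -/
structure IsSmoothSimplyConnectedDomain (Ω : Set E3) : Prop where
  isOpen : IsOpen Ω
  isBounded : Bornology.IsBounded Ω
  isSimplyConnected : IsSimplyConnected Ω
  smoothBoundary : HasSmoothBoundary Ω

section WeakDerivatives

variable {F : Type*} [NormedAddCommGroup F] [NormedSpace ℝ F]

/-- `Df` is the weak derivative of `f` on the open set `Ω`: both are locally integrable and
`∫ (∂_v φ) f = - ∫ φ (Df · v)` for all `φ ∈ C_c^∞(Ω)` and all directions `v`. -/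
def HasWeakFDeriv (Ω : Set E3) (f : E3 → F) (Df : E3 → (E3 →L[ℝ] F)) : Prop :=
  LocallyIntegrableOn f Ω ∧ LocallyIntegrableOn Df Ω ∧
  ∀ φ : E3 → ℝ, ContDiff ℝ ∞ φ → HasCompactSupport φ → tsupport φ ⊆ Ω → ∀ v : E3,
    ∫ x in Ω, (fderiv ℝ φ x v) • f x = - ∫ x in Ω, φ x • Df x v

/-- Lebesgue measure on the space-time cylinder `(0,T) × Ω`. -/
def spaceTime (Ω : Set E3) (T : ℝ) : Measure (ℝ × E3) :=
  (volume.restrict (Ioo 0 T)).prod (volume.restrict Ω)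

/-- `ft` is the weak time derivative of `f` on `(0,T) × Ω`:
`∫∫ (∂_t φ) f dx dt = - ∫∫ φ ft dx dt` for all `φ ∈ C_c^∞((0,T) × Ω)`. -/
def HasWeakTimeDeriv (Ω : Set E3) (T : ℝ) (f ft : ℝ → E3 → F) : Prop :=
  ∀ φ : ℝ × E3 → ℝ, ContDiff ℝ ∞ φ → HasCompactSupport φ → tsupport φ ⊆ Ioo 0 T ×ˢ Ω →
    ∫ t in Ioo 0 T, ∫ x in Ω, (fderiv ℝ φ (t, x) (1, 0)) • f t x
      = - ∫ t in Ioo 0 T, ∫ x in Ω, φ (t, x) • ft t x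

/-- `f ∈ C([0,T]; L^p(Ω))`. -/
def MemCLp (Ω : Set E3) (T : ℝ) (p : ℝ≥0∞) (f : ℝ → E3 → F) : Prop :=
  AEStronglyMeasurable (fun z : ℝ × E3 => f z.1 z.2) (spaceTime Ω T) ∧
  (∀ t ∈ Icc 0 T, MemLp (f t) p (volume.restrict Ω)) ∧
  ∀ t ∈ Icc 0 T, Tendsto (fun s => eLpNorm (fun x => f s x - f t x) p (volume.restrict Ω))
    (𝓝[Icc 0 T] t) (𝓝 0)

/-- `f ∈ L^r(0,T; L^p(Ω))`. -/
def MemLpLp (Ω : Set E3) (T : ℝ) (r p : ℝ≥0∞) (f : ℝ → E3 → F) : Prop :=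
  AEStronglyMeasurable (fun z : ℝ × E3 => f z.1 z.2) (spaceTime Ω T) ∧
  eLpNorm (fun t => eLpNorm (f t) p (volume.restrict Ω)) r (volume.restrict (Ioo 0 T)) < ⊤

/-- `φ ∈ H¹(Ω)`, with weak derivative `Dφ`. -/
def MemH1 (Ω : Set E3) (φ : E3 → F) (Dφ : E3 → (E3 →L[ℝ] F)) : Prop :=
  HasWeakFDeriv Ω φ Dφ ∧ MemLp φ 2 (volume.restrict Ω) ∧ MemLp Dφ 2 (volume.restrict Ω)

end WeakDerivatives

/-- The divergence `∑ᵢ ∂ᵢ wᵢ` of a field `w` whose derivative in direction `v` is `A v`. -/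
def divOf (A : E3 → E3) : ℝ := ∑ i, A (e i) i

/-- The curl `∇ × w` of a field `w` whose derivative in direction `v` is `A v`. -/
def curlOf (A : E3 → E3) : E3 :=
  !₂[A (e 1) 2 - A (e 2) 1, A (e 2) 0 - A (e 0) 2, A (e 0) 1 - A (e 1) 0]

/-- The gradient vector of a scalar function with derivative `A`. -/
def gradOf (A : E3 → ℝ) : E3 := !₂[A (e 0), A (e 1), A (e 2)]

/-- The Laplacian of a field with second derivative `B` (`B v w` is `∂_v ∂_w`). -/
def laplaceOf (B : E3 →L[ℝ] E3 →L[ℝ] E3) : E3 := ∑ i, B (e i) (e i)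

/-- The gradient of the divergence of a field with second derivative `B`. -/
def gradDivOf (B : E3 →L[ℝ] E3 →L[ℝ] E3) : E3 := gradOf fun v => divOf fun w => B v w

/-- `w · n = 0` on `∂Ω`, where `Dw` is the derivative of `w`: the normal trace of `w`, that is the
functional `φ ↦ ∫_Ω (w · ∇φ + φ div w) dx` (which is `∫_{∂Ω} (w · n) φ dS`) on `H¹(Ω)`,
vanishes. -/
def ZeroNormalTrace (Ω : Set E3) (w : E3 → E3) (Dw : E3 → E3 → E3) : Prop :=
  ∀ (φ : E3 → ℝ) (Dφ : E3 → (E3 →L[ℝ] ℝ)), MemH1 Ω φ Dφ →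
    ∫ x in Ω, (Dφ x (w x) + φ x * divOf (Dw x)) = 0

/-- `w × n = 0` on `∂Ω`, where `Dw` is the derivative of `w`: the tangential trace of `w`, that is
the functional `φ ↦ ∫_Ω (curl w · φ - w · curl φ) dx` (which is `∫_{∂Ω} (n × w) · φ dS`)
on `H¹(Ω)³`, vanishes. -/
def ZeroTangentialTrace (Ω : Set E3) (w : E3 → E3) (Dw : E3 → E3 → E3) : Prop :=
  ∀ (φ : E3 → E3) (Dφ : E3 → (E3 →L[ℝ] E3)), MemH1 Ω φ Dφ →
    ∫ x in Ω, (inner ℝ (curlOf (Dw x)) (φ x) - inner ℝ (w x) (curlOf (Dφ x))) = 0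

/-- `(ρ, u)` is a strong solution on `Ω × [0,T]` with integrability exponent `q`, the weak
derivatives being `∇ρ = Dρ`, `∂ₜρ = ρt`, `∇u = Du`, `∇²u = D2u`, `∂ₜu = ut`, `∇∂ₜu = Dut`.
The pressure is `P = ρ ^ γ`; products and the pressure are differentiated by the Leibniz and
chain rules. -/
structure IsStrongSolutionWith (Ω : Set E3) (γ mu lam T q : ℝ)
    (ρ : ℝ → E3 → ℝ) (u : ℝ → E3 → E3)
    (Dρ : ℝ → E3 → (E3 →L[ℝ] ℝ)) (ρt : ℝ → E3 → ℝ)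
    (Du : ℝ → E3 → (E3 →L[ℝ] E3)) (D2u : ℝ → E3 → (E3 →L[ℝ] E3 →L[ℝ] E3))
    (ut : ℝ → E3 → E3) (Dut : ℝ → E3 → (E3 →L[ℝ] E3)) : Prop where
  q_gt : 3 < q
  q_le : q ≤ 6
  weakDeriv_rho : ∀ t ∈ Icc 0 T, HasWeakFDeriv Ω (ρ t) (Dρ t)
  weakTimeDeriv_rho : HasWeakTimeDeriv Ω T ρ ρt
  weakDeriv_u : ∀ t ∈ Icc 0 T, HasWeakFDeriv Ω (u t) (Du t)
  weakDeriv_Du : ∀ t ∈ Icc 0 T, HasWeakFDeriv Ω (Du t) (D2u t)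
  weakTimeDeriv_u : HasWeakTimeDeriv Ω T u ut
  weakDeriv_ut : ∀ᵐ t ∂(volume.restrict (Ioo 0 T)), HasWeakFDeriv Ω (ut t) (Dut t)
  /-- `0 ≤ ρ` -/
  rho_nonneg : ∀ t ∈ Icc 0 T, ∀ᵐ x ∂(volume.restrict Ω), 0 ≤ ρ t x
  /-- `ρ ∈ C([0,T]; W^{1,q})` -/
  rho_C : MemCLp Ω T (ENNReal.ofReal q) ρ
  Drho_C : MemCLp Ω T (ENNReal.ofReal q) Dρ
  /-- `∂ₜρ ∈ C([0,T]; L^q)` -/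
  rhot_C : MemCLp Ω T (ENNReal.ofReal q) ρt
  /-- `u ∈ C([0,T]; H²)` -/
  u_C : MemCLp Ω T 2 u
  Du_C : MemCLp Ω T 2 Du
  D2u_C : MemCLp Ω T 2 D2u
  /-- `u ∈ L²(0,T; W^{2,q})` -/
  u_L2 : MemLpLp Ω T 2 (ENNReal.ofReal q) u
  Du_L2 : MemLpLp Ω T 2 (ENNReal.ofReal q) Du
  D2u_L2 : MemLpLp Ω T 2 (ENNReal.ofReal q) D2u
  /-- `√ρ ∂ₜu ∈ L^∞(0,T; L²)` -/
  sqrt_rho_ut : MemLpLp Ω T ⊤ 2 fun t x => Real.sqrt (ρ t x) • ut t x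
  /-- `∂ₜu ∈ L²(0,T; H¹)` -/
  ut_L2 : MemLpLp Ω T 2 2 ut
  Dut_L2 : MemLpLp Ω T 2 2 Dut
  /-- `ρₜ + div (ρ u) = 0` -/
  mass : ∀ᵐ z ∂(spaceTime Ω T),
    ρt z.1 z.2 + (Dρ z.1 z.2 (u z.1 z.2) + ρ z.1 z.2 * divOf (Du z.1 z.2)) = 0
  /-- `(ρ u)ₜ + div (ρ u ⊗ u) + ∇P = μ Δu + (μ + λ) ∇ div u` -/
  momentum : ∀ᵐ z ∂(spaceTime Ω T),
    (ρt z.1 z.2 • u z.1 z.2 + ρ z.1 z.2 • ut z.1 z.2)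
      + ((Dρ z.1 z.2 (u z.1 z.2) + ρ z.1 z.2 * divOf (Du z.1 z.2)) • u z.1 z.2
          + ρ z.1 z.2 • Du z.1 z.2 (u z.1 z.2))
      + (γ * ρ z.1 z.2 ^ (γ - 1)) • gradOf (Dρ z.1 z.2)
    = mu • laplaceOf (D2u z.1 z.2) + (mu + lam) • gradDivOf (D2u z.1 z.2)
  /-- `u · n = 0` on `∂Ω` -/
  normal_bc : ∀ t ∈ Ioc 0 T, ZeroNormalTrace Ω (u t) (fun x => Du t x)
  /-- `curl u × n = 0` on `∂Ω` -/
  tangential_bc : ∀ t ∈ Ioc 0 T,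
    ZeroTangentialTrace Ω (fun x => curlOf (Du t x)) (fun x v => curlOf (D2u t x v))

/-- `(ρ, u)` is a strong solution on `Ω × [0,T]`, for some `q ∈ (3, 6]`. -/
def IsStrongSolution (Ω : Set E3) (γ mu lam T : ℝ) (ρ : ℝ → E3 → ℝ) (u : ℝ → E3 → E3) : Prop :=
  ∃ q Dρ ρt Du D2u ut Dut, IsStrongSolutionWith Ω γ mu lam T q ρ u Dρ ρt Du D2u ut Dut

/-- A global strong solution with initial data `ρ(0) = ρ₀`, `(ρ u)(0) = ρ₀ u₀`. -/
structure IsGlobalStrongSolution (Ω : Set E3) (γ mu lam : ℝ) (ρ₀ : E3 → ℝ) (u₀ : E3 → E3)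
    (ρ : ℝ → E3 → ℝ) (u : ℝ → E3 → E3) : Prop where
  strong : ∀ T : ℝ, 0 < T → IsStrongSolution Ω γ mu lam T ρ u
  initial_rho : ∀ᵐ x ∂(volume.restrict Ω), ρ 0 x = ρ₀ x
  initial_momentum : ∀ᵐ x ∂(volume.restrict Ω), ρ 0 x • u 0 x = ρ₀ x • u₀ x

/-- Initial data `ρ₀ ≥ 0`, `u₀` with
`‖ρ₀ - ρ̄₀‖_{L²} + ‖√ρ₀ u₀‖_{L²} + ‖∇u₀‖_{H¹} < ∞`, where `ρ̄₀` is the mean of `ρ₀` over `Ω`. -/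
structure IsAdmissibleData (Ω : Set E3) (ρ₀ : E3 → ℝ) (u₀ : E3 → E3) : Prop where
  nonneg : ∀ᵐ x ∂(volume.restrict Ω), 0 ≤ ρ₀ x
  integrable : IntegrableOn ρ₀ Ω
  rho_L2 : MemLp (fun x => ρ₀ x - ⨍ y in Ω, ρ₀ y) 2 (volume.restrict Ω)
  momentum_L2 : MemLp (fun x => Real.sqrt (ρ₀ x) • u₀ x) 2 (volume.restrict Ω)
  grad_H1 : ∃ Du₀ D2u₀, HasWeakFDeriv Ω u₀ Du₀ ∧ MemH1 Ω Du₀ D2u₀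

end CompressibleNS

end

/-!
A vacuum cannot disappear because the density cannot form a vacuum backwards in time: if
`ρ(T) ≥ c > 0` then `ρ(0) ≥ κ > 0`. Along particle paths this is the formula
`ρ(0) = ρ(T) exp (∫ div u)` with `div u ∈ L¹(0,T; L^∞)`. The proof replaces the flow of `u` by
estimates of negative moments of the density. With `f(r) = (r² + ε)^(-p)`
(`regInvPow`) one has `|r f'(r)| ≤ 2 p f(r)`, so that the renormalized continuity equation and
`u · n = 0` give
`|d/dt ∫ f(ρ)| = |∫ (f(ρ) - ρ f'(ρ)) div u| ≤ (2 p + 1) ‖div u‖_∞ ∫ f(ρ)`,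
and by Gronwall `∫ f(ρ(0)) ≤ exp ((2 p + 1) D) ∫ f(ρ(T))` with `D` independent of `ε` and `p`
(`IsStrongSolutionWith.exists_integral_regInvPow_le`). Taking `p`-th roots as `p → ∞` bounds `ρ(0)`
from below (`IsStrongSolutionWith.exists_pos_le_initial`).

Three facts about weak derivatives carry this computation.
* The chain rule for `f(ρ)` (`HasWeakFDeriv.comp_contDiff`), by mollification. It makes `f(ρ)` an
  admissible test function for the boundary condition.
* Differentiability of `t ↦ ∫ f(ρ(t))`: the map `t ↦ ρ(t) ∈ L²(Ω)` is differentiable because the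
  weak time derivative is continuous in time (`exists_hasDerivAt_lp`), and `r ↦ ∫ f(r)` is Fréchet
  differentiable on `L²` (`hasFDerivAt_integral_comp_lp`).
* The embedding `W^{1,q}(Ω) ⊆ L^∞(Ω)` for `q > 3` (`exists_ae_norm_le_of_smoothBoundary`), which
  bounds `div u`. It is Morrey's argument on interior cones: `f(x)` is the limit as `s → 0` of
  averages of `f` over balls in the cone at `x`, of size and distance to `x` comparable to `s`, and the
  derivative of these averages in `s` is `O(s^(-3/q) ‖Df‖_q)`.
-/

noncomputable section

namespace CompressibleNS

/-! ### Mollification and the chain rule -/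

/-- A variant of Scheffé's lemma: if `h n → g` almost everywhere and `|h n| ≤ G n`, where
`G n → |g|` almost everywhere and the integrals of `G n` and `|g|` agree, then `h n → g` in `L¹`. -/
theorem tendsto_integral_abs_sub_of_dominated_integral_eq {α : Type*} [MeasurableSpace α]
    {μ : Measure α} {h G : ℕ → α → ℝ} {g : α → ℝ} (hg : Integrable g μ)
    (hh : ∀ n, Integrable (h n) μ) (hG : ∀ n, Integrable (G n) μ)
    (hhG : ∀ n x, |h n x| ≤ G n x)
    (hlim : ∀ᵐ x ∂μ, Tendsto (fun n => h n x) atTop (𝓝 (g x)))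
    (hGlim : ∀ᵐ x ∂μ, Tendsto (fun n => G n x) atTop (𝓝 |g x|))
    (hint : ∀ n, ∫ x, G n x ∂μ = ∫ x, |g x| ∂μ) :
    Tendsto (fun n => ∫ x, |h n x - g x| ∂μ) atTop (𝓝 0) := by
  -- With `E = |h n - g|` one has `E ≤ min E (2|g|) + (G n - |g|) + max (|g| - G n) 0`; the middle
  -- term has integral zero, and the outer two are dominated by multiples of `|g|`.
  have hE : ∀ n, Integrable (fun x => |h n x - g x|) μ := fun n => ((hh n).sub hg).abs
  have hA : Tendsto (fun n => ∫ x, min |h n x - g x| (2 * |g x|) ∂μ) atTop (𝓝 0) := by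
    have := tendsto_integral_of_dominated_convergence (μ := μ)
      (F := fun n x => min |h n x - g x| (2 * |g x|)) (f := fun _ => (0 : ℝ))
      (fun x => 2 * |g x|)
      (fun n => ((hE n).inf (hg.abs.const_mul 2)).aestronglyMeasurable) (hg.abs.const_mul 2)
      (fun n => Eventually.of_forall fun x => by
        rw [Real.norm_eq_abs, abs_of_nonneg (by positivity)]; exact min_le_right _ _)
      (by
        filter_upwards [hlim] with x hx
        have h1 : Tendsto (fun n => |h n x - g x|) atTop (𝓝 0) := by
          simpa using (hx.sub_const (g x)).abs
        have := h1.min (tendsto_const_nhds (x := 2 * |g x|))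
        simpa using this)
    simpa using this
  have hB : Tendsto (fun n => ∫ x, max (|g x| - G n x) 0 ∂μ) atTop (𝓝 0) := by
    have := tendsto_integral_of_dominated_convergence (μ := μ)
      (F := fun n x => max (|g x| - G n x) 0) (f := fun _ => (0 : ℝ))
      (fun x => |g x|)
      (fun n => ((hg.abs.sub (hG n)).sup (integrable_zero _ _ _)).aestronglyMeasurable) hg.abs
      (fun n => Eventually.of_forall fun x => by
        rw [Real.norm_eq_abs, abs_of_nonneg (le_max_right _ _)]
        have := (abs_nonneg _).trans (hhG n x)
        exact max_le (by linarith) (abs_nonneg _))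
      (by
        filter_upwards [hGlim] with x hx
        have h1 : Tendsto (fun n => |g x| - G n x) atTop (𝓝 0) := by
          simpa using hx.const_sub |g x|
        have := h1.max (tendsto_const_nhds (x := (0:ℝ)))
        simpa using this)
    simpa using this
  refine squeeze_zero (fun n => integral_nonneg fun x => abs_nonneg _) (fun n => ?_)
    (by simpa using hA.add hB)
  have i1 : Integrable (fun x => min |h n x - g x| (2 * |g x|)) μ :=
    (hE n).inf (hg.abs.const_mul 2)
  have i2 : Integrable (fun x => max (|g x| - G n x) 0) μ :=
    (hg.abs.sub (hG n)).sup (integrable_zero _ _ _)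
  have h0 : ∫ x, (G n x - |g x|) ∂μ = 0 := by
    rw [integral_sub (hG n) hg.abs, hint n, sub_self]
  calc ∫ x, |h n x - g x| ∂μ
      ≤ ∫ x, ((min |h n x - g x| (2 * |g x|) + max (|g x| - G n x) 0) + (G n x - |g x|)) ∂μ := by
        refine integral_mono (hE n) ((i1.add i2).add ((hG n).sub hg.abs)) fun x => ?_
        have h1 := hhG n x
        have h2 : |h n x - g x| ≤ |h n x| + |g x| := abs_sub _ _
        simp only
        rcases le_total |h n x - g x| (2 * |g x|) with h3 | h3
        · rw [min_eq_left h3]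
          linarith [le_max_left (|g x| - G n x) 0]
        · rw [min_eq_right h3]
          linarith [le_max_right (|g x| - G n x) 0]
    _ = _ := by
        have h1 : ∫ x, ((min |h n x - g x| (2 * |g x|) + max (|g x| - G n x) 0)
            + (G n x - |g x|)) ∂μ
            = ∫ x, (min |h n x - g x| (2 * |g x|) + max (|g x| - G n x) 0) ∂μ
              + ∫ x, (G n x - |g x|) ∂μ := integral_add (i1.add i2) ((hG n).sub hg.abs)
        rw [h1, h0, add_zero, integral_add i1 i2]

open ContinuousLinearMap in
/-- Mollifications of an integrable function converge to it in `L¹`. The dominating functions in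
`tendsto_integral_abs_sub_of_dominated_integral_eq` are the mollifications of `|g|`. -/
theorem tendsto_integral_abs_normed_convolution_sub {φ : ℕ → ContDiffBump (0 : E3)} {K : ℝ}
    (hφ : Tendsto (fun n => (φ n).rOut) atTop (𝓝 0))
    (hφ' : ∀ n, (φ n).rOut ≤ K * (φ n).rIn) {g : E3 → ℝ} (hg : Integrable g) :
    Tendsto (fun n => ∫ x, |(convolution ((φ n).normed volume) g (lsmul ℝ ℝ) volume) x - g x|)
      atTop (𝓝 0) := by
  have hi : ∀ n, Integrable ((φ n).normed (volume : Measure E3)) := fun n =>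
    (φ n).integrable_normed
  refine tendsto_integral_abs_sub_of_dominated_integral_eq
    (G := fun n => convolution ((φ n).normed volume) (fun x => |g x|) (lsmul ℝ ℝ) volume)
    hg (fun n => (hi n).integrable_convolution _ hg)
    (fun n => (hi n).integrable_convolution _ hg.abs) (fun n x => ?_)
    (ContDiffBump.ae_convolution_tendsto_right_of_locallyIntegrable hφ
      (Eventually.of_forall hφ') hg.locallyIntegrable)
    (ContDiffBump.ae_convolution_tendsto_right_of_locallyIntegrable hφ
      (Eventually.of_forall hφ') hg.abs.locallyIntegrable) (fun n => ?_)
  · simp only [convolution_def, lsmul_apply, smul_eq_mul]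
    refine (abs_integral_le_integral_abs).trans (le_of_eq ?_)
    congr 1; ext t
    rw [abs_mul, abs_of_nonneg ((φ n).nonneg_normed t)]
  · rw [integral_convolution _ (hi n) hg.abs, (φ n).integral_normed]
    simp

/-- Where the mollification only sees values of `f` on the compact set `K ⊆ Ω`, its derivative is
the mollification of the weak derivative of `f`. -/
theorem HasWeakFDeriv.fderiv_normed_convolution {Ω : Set E3} {f : E3 → ℝ} {Df : E3 → (E3 →L[ℝ] ℝ)}
    (hf : HasWeakFDeriv Ω f Df) {K : Set E3} (hK : IsCompact K) (hKΩ : K ⊆ Ω)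
    (φ : ContDiffBump (0 : E3)) {x : E3} (hx : Metric.closedBall x φ.rOut ⊆ K) (v : E3) :
    fderiv ℝ (convolution (φ.normed volume) (K.indicator f)
      (ContinuousLinearMap.lsmul ℝ ℝ) volume) x v
      = (convolution (φ.normed volume) (K.indicator fun y => Df y v)
        (ContinuousLinearMap.lsmul ℝ ℝ) volume) x := by
  have hKm := hK.measurableSet
  have hfi : Integrable (K.indicator f) := by
    rw [integrable_indicator_iff hKm]
    exact hf.1.integrableOn_compact_subset hKΩ hK
  have hsm : ContDiff ℝ ∞ (φ.normed (volume : Measure E3)) := φ.contDiff_normed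
  have hcs : HasCompactSupport (φ.normed (volume : Measure E3)) := φ.hasCompactSupport_normed
  have h1 := hcs.hasFDerivAt_convolution_left (μ := volume) (ContinuousLinearMap.lsmul ℝ ℝ)
    (hsm.of_le (by exact_mod_cast le_top)) hfi.locallyIntegrable x
  rw [h1.fderiv]
  set ψ : E3 → ℝ := fun y => φ.normed volume (x - y) with hψ
  have hψs : ContDiff ℝ ∞ ψ := hsm.comp (contDiff_const.sub contDiff_id)
  have hψd : ∀ y, fderiv ℝ ψ y v = - fderiv ℝ (φ.normed volume) (x - y) v := by
    intro y
    have hd : HasFDerivAt (φ.normed (volume : Measure E3)) (fderiv ℝ (φ.normed volume) (x - y))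
      (x - y) := (hsm.differentiable (by simp) _).hasFDerivAt
    have := hd.comp y ((hasFDerivAt_const x y).sub (hasFDerivAt_id y))
    have h2 : fderiv ℝ ψ y = _ := this.fderiv
    rw [h2]; simp
  have hts : tsupport ψ ⊆ Metric.closedBall x φ.rOut := by
    refine closure_minimal (fun y hy => ?_) Metric.isClosed_closedBall
    have : x - y ∈ Function.support (φ.normed (volume : Measure E3)) := hy
    rw [φ.support_normed_eq, mem_ball_zero_iff] at this
    rw [Metric.mem_closedBall, dist_comm, dist_eq_norm]
    exact le_of_lt this
  have hψc : HasCompactSupport ψ :=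
    (isCompact_closedBall x φ.rOut).of_isClosed_subset (isClosed_tsupport _) hts
  have hw := hf.2.2 ψ hψs hψc ((hts.trans hx).trans hKΩ) v
  have hsup : ∀ y, y ∉ K → ψ y = 0 := fun y hy =>
    image_eq_zero_of_notMem_tsupport fun h => hy (hx (hts h))
  have hsup' : ∀ y, y ∉ K → fderiv ℝ ψ y v = 0 := fun y hy => by
    have : y ∉ tsupport (fderiv ℝ ψ) := fun h => hy (hx (hts (tsupport_fderiv_subset ℝ h)))
    rw [image_eq_zero_of_notMem_tsupport this]; rfl
  have hci : Integrable fun t => (ContinuousLinearMap.precompL E3 (ContinuousLinearMap.lsmul ℝ ℝ :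
      ℝ →L[ℝ] ℝ →L[ℝ] ℝ)) (fderiv ℝ (φ.normed volume) (x - t)) (K.indicator f t) := by
    have := (hcs.fderiv ℝ).convolutionExists_left (μ := volume)
      (ContinuousLinearMap.precompL E3 (ContinuousLinearMap.lsmul ℝ ℝ :
      ℝ →L[ℝ] ℝ →L[ℝ] ℝ)) (hsm.continuous_fderiv (by simp)) hfi.locallyIntegrable x
    exact this.integrable_swap
  rw [convolution_eq_swap, convolution_lsmul_swap, ContinuousLinearMap.integral_apply hci]
  have e1 : ∀ H : E3 → ℝ, (∀ y, y ∉ K → H y = 0) → ∫ y in Ω, H y = ∫ y, H y := fun H h =>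
    setIntegral_eq_integral_of_forall_compl_eq_zero fun y hy => h y fun hk => hy (hKΩ hk)
  rw [e1 _ (fun y hy => by rw [hsup' y hy, zero_smul]),
    e1 _ (fun y hy => by rw [hsup y hy, zero_smul])] at hw
  calc _ = - ∫ y, fderiv ℝ ψ y v • f y := by
        rw [← integral_neg]
        congr 1; ext y
        by_cases hy : y ∈ K
        · rw [indicator_of_mem hy, hψd]; simp
        · rw [indicator_of_notMem hy, hsup' y hy]; simp
    _ = ∫ y, ψ y • Df y v := by rw [hw, neg_neg]
    _ = _ := by
        congr 1; ext y
        by_cases hy : y ∈ K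
        · rw [indicator_of_mem hy]
        · rw [indicator_of_notMem hy, hsup y hy]; simp

/-- Chain rule: if `F` is `C¹` and bounded with bounded derivative, then `F ∘ f` has the weak
derivative `F'(f) Df`. -/
theorem HasWeakFDeriv.comp_contDiff {Ω : Set E3} (hΩ : IsOpen Ω) {f : E3 → ℝ}
    {Df : E3 → (E3 →L[ℝ] ℝ)}
    (hf : HasWeakFDeriv Ω f Df) {F : ℝ → ℝ} (hF : ContDiff ℝ 1 F) {C : ℝ}
    (hFC : ∀ r, |F r| ≤ C) (hFC' : ∀ r, |deriv F r| ≤ C) :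
    HasWeakFDeriv Ω (fun x => F (f x)) (fun x => deriv F (f x) • Df x) := by
  have hF'c : Continuous (deriv F) := hF.continuous_deriv le_rfl
  have hfm : AEStronglyMeasurable f (volume.restrict Ω) := hf.1.aestronglyMeasurable
  have hDfm : AEStronglyMeasurable Df (volume.restrict Ω) := hf.2.1.aestronglyMeasurable
  refine ⟨?_, ?_, fun φ hφ hφc hφΩ v => ?_⟩
  · rw [locallyIntegrableOn_iff hΩ.isLocallyClosed]
    intro k hk hkc
    have : IsFiniteMeasure (volume.restrict k) := ⟨by simpa using hkc.measure_lt_top⟩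
    exact Integrable.of_bound ((hF.continuous.comp_aestronglyMeasurable hfm).mono_measure
        (Measure.restrict_mono hk le_rfl)) C (Eventually.of_forall fun x => hFC _)
  · rw [locallyIntegrableOn_iff hΩ.isLocallyClosed]
    intro k hk hkc
    have := hf.2.1.integrableOn_compact_subset hk hkc
    refine Integrable.bdd_smul this C ((hF'c.comp_aestronglyMeasurable hfm).mono_measure
        (Measure.restrict_mono hk le_rfl)) (Eventually.of_forall fun x => hFC' _)
  obtain ⟨δ, hδ, hδΩ⟩ := hφc.isCompact.exists_cthickening_subset_open hΩ hφΩ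
  set K := Metric.cthickening δ (tsupport φ) with hKdef
  have hK : IsCompact K := hφc.isCompact.cthickening
  have hKm := hK.measurableSet
  have hC : 0 ≤ C := (abs_nonneg _).trans (hFC 0)
  set η : ℕ → ContDiffBump (0 : E3) := fun n =>
    ⟨δ / (n + 2) / 2, δ / (n + 2), by positivity, half_lt_self (by positivity)⟩ with hη
  have hη0 : Tendsto (fun n => (η n).rOut) atTop (𝓝 0) := by
    have := (tendsto_const_div_atTop_nhds_zero_nat δ).comp (tendsto_add_atTop_nat 2)
    refine this.congr fun n => ?_
    simp [hη]
  have hη1 : ∀ n, (η n).rOut ≤ 2 * (η n).rIn := fun n => by simp only [hη]; linarith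
  have hηδ : ∀ n, (η n).rOut ≤ δ := fun n => by
    simp only [hη]
    exact div_le_self hδ.le (by linarith [(Nat.cast_nonneg n : (0:ℝ) ≤ n)])
  have hball : ∀ n, ∀ x ∈ tsupport φ, Metric.closedBall x (η n).rOut ⊆ K := fun n x hx =>
    (Metric.closedBall_subset_closedBall (hηδ n)).trans
      (Metric.closedBall_subset_cthickening hx δ)
  have hfi : Integrable (K.indicator f) := by
    rw [integrable_indicator_iff hKm]
    exact hf.1.integrableOn_compact_subset hδΩ hK
  have hgi : Integrable (K.indicator fun y => Df y v) := by
    rw [integrable_indicator_iff hKm]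
    exact (hf.2.1.integrableOn_compact_subset hδΩ hK).apply_continuousLinearMap v
  set f' := K.indicator f with hf'
  set g := K.indicator fun y => Df y v with hg'
  set fn : ℕ → E3 → ℝ := fun n => convolution ((η n).normed volume) f'
      (ContinuousLinearMap.lsmul ℝ ℝ) volume with hfn
  set gn : ℕ → E3 → ℝ := fun n => convolution ((η n).normed volume) g
      (ContinuousLinearMap.lsmul ℝ ℝ) volume with hgn
  have hfnd : ∀ n, ContDiff ℝ 1 (fn n) := fun n =>
    (η n).hasCompactSupport_normed.contDiff_convolution_left _
      ((η n).contDiff_normed) hfi.locallyIntegrable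
  have hgni : ∀ n, Integrable (gn n) := fun n =>
    ((η n).integrable_normed).integrable_convolution _ hgi
  have hlf : ∀ᵐ x, Tendsto (fun n => fn n x) atTop (𝓝 (f' x)) :=
    ContDiffBump.ae_convolution_tendsto_right_of_locallyIntegrable hη0
      (Eventually.of_forall hη1) hfi.locallyIntegrable
  have hlg := tendsto_integral_abs_normed_convolution_sub hη0 hη1 hgi
  have hφ1 : Continuous fun x => fderiv ℝ φ x v :=
    (hφ.continuous_fderiv (by simp)).clm_apply continuous_const
  have hφ1c : HasCompactSupport fun x => fderiv ℝ φ x v :=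
    (hφc.fderiv ℝ).comp_left (g := fun L : E3 →L[ℝ] ℝ => L v) rfl
  obtain ⟨M, hM⟩ := hφc.exists_bound_of_continuous hφ.continuous
  have hM0 : 0 ≤ M := (norm_nonneg _).trans (hM 0)
  have hparts : ∀ n, ∫ x, fderiv ℝ φ x v * F (fn n x)
      = - ∫ x, φ x * (deriv F (fn n x) * gn n x) := by
    intro n
    have hFf : ContDiff ℝ 1 fun x => F (fn n x) := hF.comp (hfnd n)
    have hd : ∀ x, fderiv ℝ (fun x => F (fn n x)) x v
        = deriv F (fn n x) * fderiv ℝ (fn n) x v := by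
      intro x
      have h1 := (hF.differentiable one_ne_zero (fn n x)).hasDerivAt.comp_hasFDerivAt x
        ((hfnd n).differentiable one_ne_zero x).hasFDerivAt
      have h2 : fderiv ℝ (fun x => F (fn n x)) x = _ := h1.fderiv
      rw [h2]; simp
    have hcd : Continuous fun x => fderiv ℝ (fun x => F (fn n x)) x v :=
      (hFf.continuous_fderiv one_ne_zero).clm_apply continuous_const
    have := integral_mul_fderiv_eq_neg_fderiv_mul_of_integrable (μ := (volume : Measure E3))
      (f := φ) (g := fun x => F (fn n x)) (v := v)
      ((hφ1.mul hFf.continuous).integrable_of_hasCompactSupport hφ1c.mul_right)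
      ((hφ.continuous.mul hcd).integrable_of_hasCompactSupport hφc.mul_right)
      ((hφ.continuous.mul hFf.continuous).integrable_of_hasCompactSupport hφc.mul_right)
      (fun x _ => hφ.differentiable (by simp) x)
      (fun x _ => hFf.differentiable one_ne_zero x)
    rw [← neg_eq_iff_eq_neg, ← this]
    congr 1; ext x
    by_cases hx : x ∈ tsupport φ
    · rw [hd, hf.fderiv_normed_convolution hK hδΩ (η n) (hball n x hx) v]
    · rw [image_eq_zero_of_notMem_tsupport hx, zero_mul, zero_mul]
  -- Passage to the limit in both sides of `hparts`; the right side needs `L¹` convergence of `gn`.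
  have hL1 : Tendsto (fun n => ∫ x, fderiv ℝ φ x v * F (fn n x)) atTop
      (𝓝 (∫ x, fderiv ℝ φ x v * F (f' x))) := by
    refine tendsto_integral_of_dominated_convergence (fun x => ‖fderiv ℝ φ x v‖ * C)
      (fun n => (hφ1.mul (hF.continuous.comp (hfnd n).continuous)).aestronglyMeasurable)
      ((hφ1.integrable_of_hasCompactSupport hφ1c).norm.mul_const C)
      (fun n => Eventually.of_forall fun x => ?_) ?_
    · rw [norm_mul]; exact mul_le_mul_of_nonneg_left (hFC _) (norm_nonneg _)
    · filter_upwards [hlf] with x hx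
      exact ((hF.continuous.tendsto _).comp hx).const_mul _
  have hL2 : Tendsto (fun n => ∫ x, φ x * (deriv F (fn n x) * gn n x)) atTop
      (𝓝 (∫ x, φ x * (deriv F (f' x) * g x))) := by
    have hA : Tendsto (fun n => ∫ x, φ x * (deriv F (fn n x) * g x)) atTop
        (𝓝 (∫ x, φ x * (deriv F (f' x) * g x))) := by
      refine tendsto_integral_of_dominated_convergence (fun x => M * (C * ‖g x‖))
        (fun n => hφ.continuous.aestronglyMeasurable.mul
          ((hF'c.comp (hfnd n).continuous).aestronglyMeasurable.mul hgi.aestronglyMeasurable))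
        ((hgi.norm.const_mul C).const_mul M)
        (fun n => Eventually.of_forall fun x => ?_) ?_
      · rw [norm_mul, norm_mul]
        gcongr
        · exact hM x
        · exact hFC' _
      · filter_upwards [hlf] with x hx
        exact (((hF'c.tendsto _).comp hx).mul_const _).const_mul _
    have hi : ∀ n (h : E3 → ℝ), Integrable h →
        Integrable fun x => φ x * (deriv F (fn n x) * h x) := fun n h hh =>
      (hh.bdd_mul (hF'c.comp (hfnd n).continuous).aestronglyMeasurable
        (Eventually.of_forall fun x => hFC' _)).bdd_mul hφ.continuous.aestronglyMeasurable
        (Eventually.of_forall hM)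
    have hB : Tendsto (fun n => (∫ x, φ x * (deriv F (fn n x) * gn n x))
        - ∫ x, φ x * (deriv F (fn n x) * g x)) atTop (𝓝 0) := by
      refine squeeze_zero_norm (fun n => ?_) (by simpa using hlg.const_mul (M * C))
      rw [← integral_sub (hi n _ (hgni n)) (hi n _ hgi), ← integral_const_mul]
      refine norm_integral_le_of_norm_le (((hgni n).sub hgi).abs.const_mul _)
        (Eventually.of_forall fun x => ?_)
      rw [← mul_sub, ← mul_sub, norm_mul, norm_mul, ← mul_assoc]
      gcongr
      · exact hM x
      · exact hFC' _
      · exact le_rfl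
    simpa using hB.add hA
  have hlim := tendsto_nhds_unique (hL1.congr hparts) hL2.neg
  have e1 : ∀ H : E3 → ℝ, (∀ y, y ∉ tsupport φ → H y = 0) → ∫ y in Ω, H y = ∫ y, H y :=
    fun H h => setIntegral_eq_integral_of_forall_compl_eq_zero
      fun y hy => h y fun hk => hy (hφΩ hk)
  have hs1 : ∀ y, y ∉ tsupport φ → fderiv ℝ φ y v = 0 := fun y hy => by
    have : y ∉ tsupport (fderiv ℝ φ) := fun h => hy (tsupport_fderiv_subset ℝ h)
    rw [image_eq_zero_of_notMem_tsupport this]; rfl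
  have hKs : tsupport φ ⊆ K := Metric.self_subset_cthickening _
  rw [e1 _ fun y hy => by rw [hs1 y hy, zero_smul],
    e1 _ fun y hy => by rw [image_eq_zero_of_notMem_tsupport hy, zero_smul]]
  convert hlim using 1
  · congr 1; ext x
    by_cases hx : x ∈ tsupport φ
    · rw [hf', indicator_of_mem (hKs hx), smul_eq_mul]
    · rw [hs1 x hx, zero_smul, zero_mul]
  · congr 2; ext x
    by_cases hx : x ∈ tsupport φ
    · rw [hf', hg', indicator_of_mem (hKs hx), indicator_of_mem (hKs hx)]; simp
    · rw [image_eq_zero_of_notMem_tsupport hx, zero_smul, zero_mul]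

/-! ### Averages on cones and the Sobolev embedding -/

theorem map_eq_sum_coord {F : Type*} [NormedAddCommGroup F] [NormedSpace ℝ F] (L : E3 →L[ℝ] F)
    (z : E3) : L z = ∑ i, z i • L (e i) := by
  have h := congrArg L ((EuclideanSpace.basisFun (Fin 3) ℝ).sum_repr z)
  rw [← h]
  simp only [map_sum, map_smul, EuclideanSpace.basisFun_repr, EuclideanSpace.basisFun_apply, e]

/-- The kernel `ψ`, rescaled by `s` and centred at `x`. -/
def scaledKernel (ψ : E3 → ℝ) (x : E3) (s : ℝ) (y : E3) : ℝ := (s ^ 3)⁻¹ * ψ (s⁻¹ • (y - x))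

/-- Together with `sum_fderiv_scaledKernel` this says that the derivative of the rescaled kernel in
the scale is minus the divergence, in `y`, of the field `scaledKernel ψ x s y • s⁻¹ • (y - x)`. -/
theorem hasDerivAt_scaledKernel {ψ : E3 → ℝ} (hψ : ContDiff ℝ ∞ ψ) (x y : E3) {s : ℝ}
    (hs : s ≠ 0) :
    HasDerivAt (fun s => scaledKernel ψ x s y)
      (-((s ^ 4)⁻¹ * (3 * ψ (s⁻¹ • (y - x)) + fderiv ℝ ψ (s⁻¹ • (y - x)) (s⁻¹ • (y - x))))) s := by
  have h1 : HasDerivAt (fun s : ℝ => s⁻¹ • (y - x)) ((-(s ^ 2)⁻¹) • (y - x)) s :=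
    (hasDerivAt_inv hs).smul_const _
  have h2 := (hψ.differentiable (by simp) (s⁻¹ • (y - x))).hasFDerivAt.comp_hasDerivAt s h1
  have h3 : HasDerivAt (fun s : ℝ => (s ^ 3)⁻¹) _ s := (hasDerivAt_pow 3 s).inv (pow_ne_zero 3 hs)
  have h4 := h3.mul h2
  refine HasDerivAt.congr_deriv h4 ?_
  simp only [map_smul, smul_eq_mul]
  field_simp
  simp
  ring

theorem sum_fderiv_scaledKernel {ψ : E3 → ℝ} (hψ : ContDiff ℝ ∞ ψ) (x y : E3) {s : ℝ}
    (hs : s ≠ 0) :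
    ∑ i, fderiv ℝ (fun y => scaledKernel ψ x s y * (s⁻¹ • (y - x)) i) y (e i)
      = (s ^ 4)⁻¹ * (3 * ψ (s⁻¹ • (y - x)) + fderiv ℝ ψ (s⁻¹ • (y - x)) (s⁻¹ • (y - x))) := by
  set z := s⁻¹ • (y - x) with hz
  have hd : ∀ i, fderiv ℝ (fun y => scaledKernel ψ x s y * (s⁻¹ • (y - x)) i) y (e i)
      = (s ^ 4)⁻¹ * (ψ z + fderiv ℝ ψ z (e i) * z i) := by
    intro i
    have h1 : HasFDerivAt (fun y : E3 => s⁻¹ • (y - x))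
        (s⁻¹ • ContinuousLinearMap.id ℝ E3) y :=
      ((hasFDerivAt_id y).sub_const x).const_smul s⁻¹
    have h2 := ((hψ.differentiable (by simp) z).hasFDerivAt.comp y h1).const_mul ((s ^ 3)⁻¹)
    have h3 := (EuclideanSpace.proj (𝕜 := ℝ) i).hasFDerivAt.comp y h1
    have h4 := h2.mul h3
    have h5 : fderiv ℝ (fun y => scaledKernel ψ x s y * (s⁻¹ • (y - x)) i) y = _ := h4.fderiv
    rw [h5]
    simp [e, ← hz]
    field_simp
  simp_rw [hd]
  rw [← Finset.mul_sum, Finset.sum_add_distrib]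
  congr 2
  · simp
  · rw [map_eq_sum_coord (fderiv ℝ ψ z) z]
    exact Finset.sum_congr rfl fun i _ => mul_comm _ _

section

variable {F : Type*} [NormedAddCommGroup F] [NormedSpace ℝ F]

theorem contDiff_scaledKernel {ψ : E3 → ℝ} (hψ : ContDiff ℝ ∞ ψ) (x : E3) (s : ℝ) :
    ContDiff ℝ ∞ (scaledKernel ψ x s) :=
  contDiff_const.mul (hψ.comp ((contDiff_id.sub contDiff_const).const_smul _))

theorem scaledKernel_ne_zero_subset (ψ : E3 → ℝ) (x : E3) {s : ℝ} (hs : s ≠ 0) :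
    Function.support (scaledKernel ψ x s) ⊆ (fun z => x + s • z) '' tsupport ψ := by
  intro y hy
  refine ⟨s⁻¹ • (y - x), subset_tsupport _ fun h => hy ?_, ?_⟩
  · rw [scaledKernel, h, mul_zero]
  · simp [smul_smul, mul_inv_cancel₀ hs]

/-- The weak derivative tested with `scaledKernel ψ x s y • s⁻¹ • (y - x)`, which is supported in
`x + s • tsupport ψ`. -/
theorem HasWeakFDeriv.integral_scaledKernel {Ω : Set E3} {f : E3 → F} {Df : E3 → (E3 →L[ℝ] F)}
    (hf : HasWeakFDeriv Ω f Df) {ψ : E3 → ℝ} (hψ : ContDiff ℝ ∞ ψ) (hψc : HasCompactSupport ψ)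
    {x : E3} {s : ℝ} (hs : s ≠ 0) (hcone : ∀ z ∈ tsupport ψ, x + s • z ∈ Ω) :
    ∫ y in Ω, (-((s ^ 4)⁻¹ * (3 * ψ (s⁻¹ • (y - x))
        + fderiv ℝ ψ (s⁻¹ • (y - x)) (s⁻¹ • (y - x))))) • f y
      = ∫ y in Ω, scaledKernel ψ x s y • Df y (s⁻¹ • (y - x)) := by
  set φ : Fin 3 → E3 → ℝ := fun i y => scaledKernel ψ x s y * (s⁻¹ • (y - x)) i with hφ
  have hφs : ∀ i, ContDiff ℝ ∞ (φ i) := fun i =>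
    (contDiff_scaledKernel hψ x s).mul
      ((EuclideanSpace.proj (𝕜 := ℝ) i).contDiff.comp
        ((contDiff_id.sub contDiff_const).const_smul (s⁻¹)))
  set k : Set E3 := (fun z => x + s • z) '' tsupport ψ with hk
  have hkc : IsCompact k := hψc.isCompact.image (by fun_prop)
  have hkΩ : k ⊆ Ω := by rintro _ ⟨z, hz, rfl⟩; exact hcone z hz
  have hts : ∀ i, tsupport (φ i) ⊆ k := fun i =>
    closure_minimal ((Function.support_mul_subset_left _ _).trans
      (scaledKernel_ne_zero_subset ψ x hs)) hkc.isClosed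
  have hφc : ∀ i, HasCompactSupport (φ i) := fun i =>
    hkc.of_isClosed_subset (isClosed_tsupport _) (hts i)
  have hw := fun i => hf.2.2 (φ i) (hφs i) (hφc i) ((hts i).trans hkΩ) (e i)
  have hbd : ∀ (H : E3 → ℝ), Continuous H → HasCompactSupport H → tsupport H ⊆ k →
      ∀ {G : Type _} [NormedAddCommGroup G] [NormedSpace ℝ G] (g : E3 → G),
        LocallyIntegrableOn g Ω → Integrable (fun y => H y • g y) (volume.restrict Ω) := by
    intro H hH hHc hHk G _ _ g hg
    obtain ⟨M, hM⟩ := hHc.exists_bound_of_continuous hH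
    have h1 : IntegrableOn (fun y => H y • g y) k :=
      Integrable.bdd_smul (hg.integrableOn_compact_subset hkΩ hkc) M
        hH.aestronglyMeasurable (Eventually.of_forall hM)
    have h2 : Integrable (fun y => H y • g y) := by
      refine (integrableOn_iff_integrable_of_support_subset ?_).1 h1
      exact (Function.support_smul_subset_left _ _).trans ((subset_tsupport _).trans hHk)
    exact h2.integrableOn
  have hi1 : ∀ i, Integrable (fun y => fderiv ℝ (φ i) y (e i) • f y) (volume.restrict Ω) := by
    intro i
    refine hbd (fun y => fderiv ℝ (φ i) y (e i))
      (((hφs i).continuous_fderiv (by simp)).clm_apply continuous_const)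
      (((hφc i).fderiv ℝ).comp_left (g := fun L : E3 →L[ℝ] ℝ => L (e i)) rfl) ?_ f hf.1
    refine Subset.trans (closure_mono ?_) ((tsupport_fderiv_subset ℝ (f := φ i)).trans (hts i))
    intro y hy h0
    exact hy (by simp only [h0]; rfl)
  have hi2 : ∀ i, Integrable (fun y => φ i y • Df y (e i)) (volume.restrict Ω) := by
    intro i
    have h1 := hbd (φ i) (hφs i).continuous (hφc i) (hts i) Df hf.2.1
    exact h1.apply_continuousLinearMap (e i)
  calc _ = ∫ y in Ω, - ∑ i, fderiv ℝ (φ i) y (e i) • f y := by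
        congr 1; ext y
        rw [← Finset.sum_smul, sum_fderiv_scaledKernel hψ x y hs, neg_smul]
    _ = ∑ i, ∫ y in Ω, φ i y • Df y (e i) := by
        rw [integral_neg, integral_finsetSum _ fun i _ => hi1 i, ← Finset.sum_neg_distrib]
        exact Finset.sum_congr rfl fun i _ => by rw [hw i, neg_neg]
    _ = ∫ y in Ω, ∑ i, φ i y • Df y (e i) := (integral_finsetSum _ fun i _ => hi2 i).symm
    _ = _ := by
        congr 1; ext y
        rw [map_eq_sum_coord (Df y) (s⁻¹ • (y - x))]
        simp only [Finset.smul_sum, smul_smul, hφ]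

/-- The averages of `f` against the rescaled kernel are differentiable in the scale, with derivative
an average of the weak derivative of `f`. -/
theorem HasWeakFDeriv.hasDerivAt_integral_scaledKernel {Ω : Set E3} {f : E3 → F}
    {Df : E3 → (E3 →L[ℝ] F)}
    (hf : HasWeakFDeriv Ω f Df) (hfi : IntegrableOn f Ω) {ψ : E3 → ℝ} (hψ : ContDiff ℝ ∞ ψ)
    (hψc : HasCompactSupport ψ)
    {x : E3} {s : ℝ} (hs : 0 < s) (hcone : ∀ z ∈ tsupport ψ, x + s • z ∈ Ω) :
    HasDerivAt (fun s => ∫ y in Ω, scaledKernel ψ x s y • f y)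
      (∫ y in Ω, scaledKernel ψ x s y • Df y (s⁻¹ • (y - x))) s := by
  set θ : E3 → ℝ := fun z => 3 * ψ z + fderiv ℝ ψ z z with hθ
  have hθc : Continuous θ := (continuous_const.mul hψ.continuous).add
    ((hψ.continuous_fderiv (by simp)).clm_apply continuous_id)
  have hθcs : HasCompactSupport θ := by
    refine HasCompactSupport.intro hψc.isCompact fun z hz => ?_
    have h2 : z ∉ tsupport (fderiv ℝ ψ) := fun h => hz (tsupport_fderiv_subset ℝ h)
    simp only [hθ]
    rw [image_eq_zero_of_notMem_tsupport hz, image_eq_zero_of_notMem_tsupport h2]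
    simp
  obtain ⟨M, hM⟩ := hψc.exists_bound_of_continuous hψ.continuous
  obtain ⟨M', hM'⟩ := hθcs.exists_bound_of_continuous hθc
  have hM'0 : 0 ≤ M' := (norm_nonneg _).trans (hM' 0)
  have hkb : ∀ t y, ‖scaledKernel ψ x t y‖ ≤ ‖(t ^ 3)⁻¹‖ * M := fun t y => by
    rw [scaledKernel, norm_mul]; gcongr; exact hM _
  have hkm : ∀ t, AEStronglyMeasurable (scaledKernel ψ x t) (volume.restrict Ω) := fun t =>
    (contDiff_scaledKernel hψ x t).continuous.aestronglyMeasurable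
  rw [← hf.integral_scaledKernel hψ hψc hs.ne' hcone]
  refine (hasDerivAt_integral_of_dominated_loc_of_deriv_le (s := Ioi (s / 2))
    (F := fun s y => scaledKernel ψ x s y • f y)
    (F' := fun s y => (-((s ^ 4)⁻¹ * θ (s⁻¹ • (y - x)))) • f y)
    (bound := fun y => (((s / 2) ^ 4)⁻¹ * M') * ‖f y‖)
    (Ioi_mem_nhds (by linarith)) (Eventually.of_forall fun t => (hkm t).smul hfi.1)
    (Integrable.bdd_smul hfi _ (hkm s) (Eventually.of_forall (hkb s))) ?_ ?_
    (hfi.norm.const_mul _) ?_).2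
  · refine AEStronglyMeasurable.smul ?_ hfi.1
    have : Continuous fun y => -((s ^ 4)⁻¹ * θ (s⁻¹ • (y - x))) := by fun_prop
    exact this.aestronglyMeasurable
  · refine Eventually.of_forall fun y t ht => ?_
    have ht' : s / 2 < t := ht
    rw [norm_smul, norm_neg, norm_mul, Real.norm_of_nonneg (by positivity)]
    gcongr
    exact hM' _
  · refine Eventually.of_forall fun y t ht => ?_
    have ht' : s / 2 < t := ht
    exact (hasDerivAt_scaledKernel hψ x y (by linarith : (0:ℝ) < t).ne').smul_const (f y)

/-- By Hölder's inequality on the ball of radius `R s`, the derivative of the averages in the scale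
is `O(s ^ (-3 / q))`, which is integrable at `s = 0` when `q > 3`. -/
theorem norm_integral_scaledKernel_le {Ω : Set E3} {G : E3 → (E3 →L[ℝ] F)} {q : ℝ} (hq : 1 ≤ q)
    (hG : MemLp G (ENNReal.ofReal q) (volume.restrict Ω)) {ψ : E3 → ℝ} {M R : ℝ} (hR : 0 < R)
    (hM : ∀ z, |ψ z| ≤ M) (hψR : ∀ z, R < ‖z‖ → ψ z = 0) (x : E3) {s : ℝ} (hs : 0 < s) :
    ‖∫ y in Ω, scaledKernel ψ x s y • G y (s⁻¹ • (y - x))‖ ≤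
      M * R * (R ^ 3 * volume.real (Metric.ball (0 : E3) 1)) ^ (1 - 1 / q) *
        (eLpNorm G (ENNReal.ofReal q) (volume.restrict Ω)).toReal * s ^ (-(3 / q)) := by
  have hM0 : 0 ≤ M := (abs_nonneg _).trans (hM 0)
  set B := Metric.closedBall x (R * s) with hB
  have hBm : MeasurableSet B := Metric.isClosed_closedBall.measurableSet
  set μ := (volume.restrict Ω).restrict B with hμ
  have hGB : MemLp G (ENNReal.ofReal q) μ := hG.restrict B
  have hBfin : volume B ≠ ⊤ := measure_closedBall_lt_top.ne
  have hμu : μ univ ≤ volume B := by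
    rw [hμ, Measure.restrict_apply_univ]; exact Measure.restrict_apply_le _ _
  have hfin : IsFiniteMeasure μ := ⟨hμu.trans_lt hBfin.lt_top⟩
  have hq1 : (1 : ℝ≥0∞) ≤ ENNReal.ofReal q := by simpa using ENNReal.ofReal_le_ofReal hq
  have hGi : Integrable G μ := hGB.integrable hq1
  have hq0 : 0 < q := by linarith
  have hexp : 0 ≤ 1 - 1 / q := by
    rw [sub_nonneg, div_le_one hq0]; exact hq
  set N := (eLpNorm G (ENNReal.ofReal q) (volume.restrict Ω)).toReal with hN
  have hL1 : ∫ y, ‖G y‖ ∂μ ≤ N * (volume.real B) ^ (1 - 1 / q) := by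
    have h1 := eLpNorm_le_eLpNorm_mul_rpow_measure_univ hq1 hGB.1
    rw [ENNReal.toReal_one, ENNReal.toReal_ofReal hq0.le, div_one] at h1
    have h2 : eLpNorm G 1 μ ≤ eLpNorm G (ENNReal.ofReal q) (volume.restrict Ω)
        * volume B ^ (1 - 1 / q) := by
      refine h1.trans ?_
      gcongr
      exact Measure.restrict_le_self
    rw [integral_norm_eq_lintegral_enorm hGB.1, ← eLpNorm_one_eq_lintegral_enorm, measureReal_def,
      hN, ENNReal.toReal_rpow, ← ENNReal.toReal_mul]
    exact ENNReal.toReal_mono (ENNReal.mul_ne_top hG.2.ne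
      (ENNReal.rpow_ne_top_of_nonneg hexp hBfin)) h2
  have hpt : ∀ y, ‖scaledKernel ψ x s y • G y (s⁻¹ • (y - x))‖
      ≤ B.indicator (fun y => (s ^ 3)⁻¹ * M * R * ‖G y‖) y := by
    intro y
    by_cases hy : y ∈ B
    · rw [indicator_of_mem hy, norm_smul, scaledKernel, norm_mul, Real.norm_eq_abs,
        Real.norm_eq_abs, abs_of_pos (by positivity : (0:ℝ) < (s ^ 3)⁻¹)]
      have h1 : ‖s⁻¹ • (y - x)‖ ≤ R := by
        rw [norm_smul, norm_inv, Real.norm_of_nonneg hs.le, inv_mul_le_iff₀ hs, ← dist_eq_norm,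
          mul_comm]
        exact hy
      have h2 : ‖G y (s⁻¹ • (y - x))‖ ≤ ‖G y‖ * R :=
        ((G y).le_opNorm _).trans (by gcongr)
      calc _ ≤ (s ^ 3)⁻¹ * M * (‖G y‖ * R) := by
            gcongr
            exact hM _
        _ = _ := by ring
    · rw [indicator_of_notMem hy]
      have : scaledKernel ψ x s y = 0 := by
        rw [scaledKernel, hψR, mul_zero]
        rw [norm_smul, norm_inv, Real.norm_of_nonneg hs.le, lt_inv_mul_iff₀ hs, ← dist_eq_norm,
          mul_comm]
        exact not_le.1 hy
      rw [this]; simp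
  have hmain : ‖∫ y in Ω, scaledKernel ψ x s y • G y (s⁻¹ • (y - x))‖
      ≤ (s ^ 3)⁻¹ * M * R * ∫ y, ‖G y‖ ∂μ := by
    refine (norm_integral_le_of_norm_le (g := B.indicator fun y => (s ^ 3)⁻¹ * M * R * ‖G y‖)
      ?_ (Eventually.of_forall hpt)).trans (le_of_eq ?_)
    · rw [integrable_indicator_iff hBm]
      exact hGi.norm.const_mul _
    · rw [integral_indicator hBm, integral_const_mul]
  refine hmain.trans ((mul_le_mul_of_nonneg_left hL1 (by positivity)).trans (le_of_eq ?_))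
  have hvB : volume.real B = s ^ 3 * (R ^ 3 * volume.real (Metric.ball (0 : E3) 1)) := by
    rw [hB, Measure.addHaar_real_closedBall _ _ (by positivity), finrank_euclideanSpace_fin]
    ring
  have hs3 : (s ^ 3) ^ (1 - 1 / q) = s ^ 3 * s ^ (-(3 / q)) := by
    rw [← Real.rpow_natCast, ← Real.rpow_mul hs.le, ← Real.rpow_add hs]
    congr 1; push_cast; ring
  rw [hvB, Real.mul_rpow (by positivity) (by positivity), hs3]
  field_simp

/-- At almost every point the averages converge to the value of `f` as the scale tends to zero. The
kernel need not be centred: it is supported in a ball around `x` of comparable volume. -/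
theorem ae_tendsto_integral_scaledKernel [CompleteSpace F] {Ω : Set E3} (hΩ : MeasurableSet Ω)
    {f : E3 → F} (hf : IntegrableOn f Ω) {ψ : E3 → ℝ} {M R : ℝ} (hR : 0 < R)
    (hM : ∀ z, |ψ z| ≤ M) (hψR : ∀ z, R < ‖z‖ → ψ z = 0) (hψ1 : ∫ z, ψ z = 1) :
    ∀ᵐ x, x ∈ Ω → Tendsto (fun s => ∫ y in Ω, scaledKernel ψ x s y • f y) (𝓝[>] 0)
      (𝓝 (f x)) := by
  have hfi : Integrable (Ω.indicator f) := by rwa [integrable_indicator_iff hΩ]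
  filter_upwards [IsUnifLocDoublingMeasure.ae_tendsto_average_norm_sub volume
    hfi.locallyIntegrable 1] with x hx hxΩ
  have hδ : Tendsto (fun s : ℝ => R * s) (𝓝[>] 0) (𝓝[>] 0) := by
    refine tendsto_nhdsWithin_iff.2 ⟨?_, ?_⟩
    · have : Tendsto (fun s : ℝ => R * s) (𝓝 0) (𝓝 (R * 0)) := (continuous_const_mul R).tendsto 0
      rw [mul_zero] at this
      exact this.mono_left nhdsWithin_le_nhds
    · filter_upwards [self_mem_nhdsWithin] with s hs using mul_pos hR hs
  have h0 := hx (fun _ => x) (fun s : ℝ => R * s) hδ (by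
    filter_upwards [self_mem_nhdsWithin] with s hs
    exact Metric.mem_closedBall_self (by have : 0 < s := hs; positivity))
  rw [indicator_of_mem hxΩ] at h0
  have h1 := tendsto_integral_smul_of_tendsto_average_norm_sub (μ := volume)
    (a := fun s : ℝ => Metric.closedBall x (R * s)) (g := fun s => scaledKernel ψ x s)
    (M * (R ^ 3 * volume.real (Metric.ball (0 : E3) 1))) h0
    (Eventually.of_forall fun s => hfi.integrableOn) ?_ ?_ ?_
  · refine h1.congr fun s => ?_
    rw [← integral_indicator hΩ]
    congr 1; ext y
    by_cases hy : y ∈ Ω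
    · simp [hy]
    · simp [hy]
  · refine tendsto_const_nhds.congr' ?_
    filter_upwards [self_mem_nhdsWithin] with s hs
    have hs : 0 < s := hs
    simp only [scaledKernel]
    rw [integral_const_mul, integral_sub_right_eq_self (fun y => ψ (s⁻¹ • y)) x,
      Measure.integral_comp_inv_smul, hψ1, finrank_euclideanSpace_fin, abs_of_pos (by positivity)]
    simp [hs.ne']
  · filter_upwards [self_mem_nhdsWithin] with s hs y hy
    have hs : 0 < s := hs
    by_contra h
    refine hy ?_
    rw [scaledKernel, hψR, mul_zero]
    rw [norm_smul, norm_inv, Real.norm_of_nonneg hs.le, lt_inv_mul_iff₀ hs, ← dist_eq_norm,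
          mul_comm]
    exact not_le.1 h
  · filter_upwards [self_mem_nhdsWithin] with s hs y
    have hs : 0 < s := hs
    have hv : 0 < volume.real (Metric.ball (0 : E3) 1) :=
      ENNReal.toReal_pos (Metric.measure_ball_pos _ _ one_pos).ne' measure_ball_lt_top.ne
    rw [Measure.addHaar_real_closedBall _ _ (by positivity), finrank_euclideanSpace_fin,
      scaledKernel, abs_mul, abs_of_pos (by positivity : (0:ℝ) < (s ^ 3)⁻¹)]
    calc (s ^ 3)⁻¹ * |ψ (s⁻¹ • (y - x))| ≤ (s ^ 3)⁻¹ * M := by gcongr; exact hM _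
      _ = _ := by field_simp

end

/-- Uniform interior cone condition: near every point of its closure, a smooth open set contains the
truncated cone over a fixed ball at each of its points. At a boundary point, the axis `ν` is a
direction in which the defining function decreases. -/
theorem exists_cone_nhds {Ω : Set E3} (hΩ : IsOpen Ω) (hb : HasSmoothBoundary Ω) {x₀ : E3}
    (hx₀ : x₀ ∈ closure Ω) :
    ∃ U ∈ 𝓝 x₀, ∃ (ν : E3) (δ h : ℝ), 0 < δ ∧ 0 < h ∧ ∀ x ∈ U, x ∈ Ω → ∀ s ∈ Ioc 0 h,
      ∀ z ∈ Metric.closedBall ν δ, x + s • z ∈ Ω := by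
  by_cases hx : x₀ ∈ Ω
  · obtain ⟨r, hr, hrΩ⟩ := Metric.isOpen_iff.1 hΩ x₀ hx
    refine ⟨Metric.ball x₀ (r / 2), Metric.ball_mem_nhds _ (by positivity), 0, 1, r / 2,
      one_pos, by positivity, fun x hxU _ s hs z hz => hrΩ ?_⟩
    rw [mem_closedBall_zero_iff] at hz
    rw [Metric.mem_ball] at hxU ⊢
    have h1 : dist (x + s • z) x ≤ r / 2 := by
      rw [dist_eq_norm, add_sub_cancel_left, norm_smul, Real.norm_of_nonneg hs.1.le]
      nlinarith [hs.1, hs.2, norm_nonneg z]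
    linarith [dist_triangle (x + s • z) x x₀]
  · have hfr : x₀ ∈ frontier Ω := ⟨hx₀, by rwa [hΩ.interior_eq]⟩
    obtain ⟨g, hg, hg0, hgΩ⟩ := hb x₀ hfr
    obtain ⟨v, hv⟩ : ∃ v, fderiv ℝ g x₀ v ≠ 0 := by
      by_contra! h
      exact hg0 (ContinuousLinearMap.ext h)
    set ν : E3 := (-(fderiv ℝ g x₀ v)⁻¹) • v with hν
    have hν1 : fderiv ℝ g x₀ ν < 0 := by
      rw [hν, map_smul, smul_eq_mul, neg_mul, inv_mul_cancel₀ hv]; norm_num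
    have hcont : Continuous fun p : E3 × E3 => fderiv ℝ g p.1 p.2 :=
      ((hg.continuous_fderiv (by simp)).comp continuous_fst).clm_apply continuous_snd
    have hev : ∀ᶠ p : E3 × E3 in 𝓝 (x₀, ν), fderiv ℝ g p.1 p.2 < 0 :=
      hcont.continuousAt.eventually (gt_mem_nhds hν1)
    rw [nhds_prod_eq, Filter.eventually_prod_iff] at hev
    obtain ⟨pa, hpa, pb, hpb, hab⟩ := hev
    obtain ⟨r, hr, hrp⟩ := Metric.eventually_nhds_iff_ball.1 (hpa.and hgΩ)
    obtain ⟨δ, hδ, hδp⟩ := Metric.nhds_basis_closedBall.eventually_iff.1 hpb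
    set h := r / 2 / (‖ν‖ + δ + 1) with hh
    have hpos : 0 < ‖ν‖ + δ + 1 := by positivity
    refine ⟨Metric.ball x₀ (r / 2), Metric.ball_mem_nhds _ (by positivity), ν, δ, h,
      hδ, by positivity, fun x hxU hxΩ s hs z hz => ?_⟩
    have hzn : ‖z‖ ≤ ‖ν‖ + δ := by
      have h1 := norm_le_norm_add_norm_sub' z ν
      rw [Metric.mem_closedBall, dist_eq_norm] at hz
      linarith
    have hin : ∀ t ∈ Icc 0 h, x + t • z ∈ Metric.ball x₀ r := by
      intro t ht
      rw [Metric.mem_ball] at hxU ⊢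
      have h1 : dist (x + t • z) x ≤ r / 2 := by
        rw [dist_eq_norm, add_sub_cancel_left, norm_smul, Real.norm_of_nonneg ht.1]
        calc t * ‖z‖ ≤ h * (‖ν‖ + δ + 1) :=
              mul_le_mul ht.2 (by linarith) (norm_nonneg _) (ht.1.trans ht.2)
          _ = r / 2 := by rw [hh]; field_simp
      linarith [dist_triangle (x + t • z) x x₀]
    have hd : ∀ t, HasDerivAt (fun t : ℝ => g (x + t • z)) (fderiv ℝ g (x + t • z) z) t := by
      intro t
      have h1 : HasDerivAt (fun t : ℝ => x + t • z) z t := by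
        simpa using ((hasDerivAt_id t).smul_const z).const_add x
      exact (hg.differentiable (by simp) _).hasFDerivAt.comp_hasDerivAt t h1
    have hanti : AntitoneOn (fun t : ℝ => g (x + t • z)) (Icc 0 h) := by
      refine antitoneOn_of_deriv_nonpos (convex_Icc 0 h)
        (fun t _ => (hd t).continuousAt.continuousWithinAt)
        (fun t _ => (hd t).differentiableAt.differentiableWithinAt) fun t ht => ?_
      rw [(hd t).deriv]
      exact (hab (hrp _ (hin t (interior_subset ht))).1 (hδp hz)).le
    have hs' : s ∈ Icc 0 h := ⟨hs.1.le, hs.2⟩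
    have h0 : (0 : ℝ) ∈ Icc 0 h := ⟨le_rfl, hs.1.le.trans hs.2⟩
    have h1 := hanti h0 hs' hs.1.le
    simp only [zero_smul, add_zero] at h1
    have hx0 := ((hrp x (by simpa using hin 0 h0)).2).1 hxΩ
    exact ((hrp _ (hin s hs')).2).2 (h1.trans_lt hx0)

/-- Morrey's estimate at the points `x` for which `Ω` contains the cone `x + s • tsupport ψ`,
`0 < s ≤ h`: the constant depends on neither `f` nor `x`. -/
theorem exists_ae_norm_le_of_cone {F : Type*} [NormedAddCommGroup F] [NormedSpace ℝ F]
    [CompleteSpace F] {Ω : Set E3} (hΩ : IsOpen Ω)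
    (hΩf : volume Ω ≠ ⊤) {q : ℝ} (hq : 3 < q) {ψ : E3 → ℝ} (hψ : ContDiff ℝ ∞ ψ)
    (hψc : HasCompactSupport ψ) (hψ1 : ∫ z, ψ z = 1) {h : ℝ} (hh : 0 < h) :
    ∃ C : ℝ, 0 ≤ C ∧ ∀ (f : E3 → F) (Df : E3 → (E3 →L[ℝ] F)), HasWeakFDeriv Ω f Df →
      MemLp f (ENNReal.ofReal q) (volume.restrict Ω) →
      MemLp Df (ENNReal.ofReal q) (volume.restrict Ω) →
      ∀ᵐ x, x ∈ Ω → (∀ s ∈ Ioc 0 h, ∀ z ∈ tsupport ψ, x + s • z ∈ Ω) →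
        ‖f x‖ ≤ C * ((eLpNorm f (ENNReal.ofReal q) (volume.restrict Ω)).toReal
          + (eLpNorm Df (ENNReal.ofReal q) (volume.restrict Ω)).toReal) := by
  obtain ⟨M, hM⟩ := hψc.exists_bound_of_continuous hψ.continuous
  have hM0 : 0 ≤ M := (norm_nonneg _).trans (hM 0)
  obtain ⟨R, hR, hψR'⟩ : ∃ R : ℝ, 0 < R ∧ ∀ z ∈ tsupport ψ, ‖z‖ ≤ R :=
    hψc.isCompact.isBounded.exists_pos_norm_le
  have hψR : ∀ z, R < ‖z‖ → ψ z = 0 := fun z hz =>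
    image_eq_zero_of_notMem_tsupport fun hz' => absurd (hψR' z hz') (not_le.2 hz)
  have hq0 : 0 < q := by linarith
  have hq1 : (1 : ℝ≥0∞) ≤ ENNReal.ofReal q := by
    simpa using ENNReal.ofReal_le_ofReal (by linarith : (1 : ℝ) ≤ q)
  have hfin : IsFiniteMeasure (volume.restrict Ω) := ⟨by simpa using hΩf.lt_top⟩
  set α := 1 - 3 / q with hα
  have hα0 : 0 < α := by rw [hα, sub_pos, div_lt_one hq0]; exact hq
  have hexp : 0 ≤ 1 - 1 / q := by
    rw [sub_nonneg, div_le_one hq0]; linarith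
  set A := M * R * (R ^ 3 * volume.real (Metric.ball (0 : E3) 1)) ^ (1 - 1 / q) with hA
  have hA0 : 0 ≤ A := by positivity
  set C₁ := (h ^ 3)⁻¹ * M * (volume.real Ω) ^ (1 - 1 / q) with hC₁
  set C₂ := A * (h ^ α / α) with hC₂
  have hC₁0 : 0 ≤ C₁ := by positivity
  have hC₂0 : 0 ≤ C₂ := by positivity
  refine ⟨C₁ + C₂, by positivity, fun f Df hf hfq hDq => ?_⟩
  set Nf := (eLpNorm f (ENNReal.ofReal q) (volume.restrict Ω)).toReal with hNf
  set N := (eLpNorm Df (ENNReal.ofReal q) (volume.restrict Ω)).toReal with hN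
  have hNf0 : 0 ≤ Nf := ENNReal.toReal_nonneg
  have hN0 : 0 ≤ N := ENNReal.toReal_nonneg
  have hfi : IntegrableOn f Ω := hfq.integrable hq1
  have hL1 : ∫ y in Ω, ‖f y‖ ≤ Nf * (volume.real Ω) ^ (1 - 1 / q) := by
    have h1 := eLpNorm_le_eLpNorm_mul_rpow_measure_univ hq1 hfq.1
    rw [ENNReal.toReal_one, ENNReal.toReal_ofReal hq0.le, div_one,
      Measure.restrict_apply_univ] at h1
    rw [integral_norm_eq_lintegral_enorm hfq.1, ← eLpNorm_one_eq_lintegral_enorm, measureReal_def,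
      hNf, ENNReal.toReal_rpow, ← ENNReal.toReal_mul]
    exact ENNReal.toReal_mono (ENNReal.mul_ne_top hfq.2.ne
      (ENNReal.rpow_ne_top_of_nonneg hexp hΩf)) h1
  filter_upwards [ae_tendsto_integral_scaledKernel hΩ.measurableSet hfi hR hM hψR hψ1]
    with x hx hxΩ hcone
  set I : ℝ → F := fun s => ∫ y in Ω, scaledKernel ψ x s y • f y with hI
  have hId : ∀ s ∈ Ioc 0 h, HasDerivAt I
      (∫ y in Ω, scaledKernel ψ x s y • Df y (s⁻¹ • (y - x))) s := fun s hs =>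
    hf.hasDerivAt_integral_scaledKernel hfi hψ hψc hs.1 (hcone s hs)
  have hIh : ‖I h‖ ≤ C₁ * Nf := by
    calc ‖I h‖ ≤ ∫ y in Ω, (h ^ 3)⁻¹ * M * ‖f y‖ := by
          refine norm_integral_le_of_norm_le (hfi.norm.const_mul _)
            (Eventually.of_forall fun y => ?_)
          rw [norm_smul, scaledKernel, norm_mul, Real.norm_of_nonneg (by positivity)]
          gcongr
          exact hM _
      _ ≤ (h ^ 3)⁻¹ * M * (Nf * (volume.real Ω) ^ (1 - 1 / q)) := by
          rw [integral_const_mul]; gcongr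
      _ = C₁ * Nf := by rw [hC₁]; ring
  have hstep : ∀ s ∈ Ioo 0 h, ‖I s‖ ≤ C₁ * Nf + C₂ * N := by
    intro s hs
    have hB : ∀ t ∈ Icc s h, HasDerivAt (fun t : ℝ => A * N * ((t ^ α - s ^ α) / α))
        (A * N * t ^ (-(3 / q))) t := by
      intro t ht
      have ht0 : 0 < t := hs.1.trans_le ht.1
      have h1 := (((Real.hasDerivAt_rpow_const (p := α) (Or.inl ht0.ne')).sub_const
        (s ^ α)).div_const α).const_mul (A * N)
      refine h1.congr_deriv ?_
      rw [mul_div_cancel_left₀ _ hα0.ne', show α - 1 = -(3 / q) by rw [hα]; ring]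
    have h1 := image_norm_le_of_norm_deriv_right_le_deriv_boundary' (a := s) (b := h)
      (f := fun t => I t - I s)
      (f' := fun t => ∫ y in Ω, scaledKernel ψ x t y • Df y (t⁻¹ • (y - x)))
      (B := fun t : ℝ => A * N * ((t ^ α - s ^ α) / α))
      (B' := fun t => A * N * t ^ (-(3 / q)))
      (fun t ht => ((hId t ⟨hs.1.trans_le ht.1, ht.2⟩).sub_const
        (I s)).continuousAt.continuousWithinAt)
      (fun t ht => ((hId t ⟨hs.1.trans_le ht.1, ht.2.le⟩).sub_const (I s)).hasDerivWithinAt)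
      (by simp) (fun t ht => (hB t ht).continuousAt.continuousWithinAt)
      (fun t ht => (hB t ⟨ht.1, ht.2.le⟩).hasDerivWithinAt)
      (fun t ht => norm_integral_scaledKernel_le (by linarith) hDq hR hM hψR x
        (hs.1.trans_le ht.1)) (right_mem_Icc.2 hs.2.le)
    have h2 : A * N * ((h ^ α - s ^ α) / α) ≤ C₂ * N := by
      have : 0 ≤ s ^ α := Real.rpow_nonneg hs.1.le _
      calc A * N * ((h ^ α - s ^ α) / α) ≤ A * N * (h ^ α / α) := by gcongr; linarith
        _ = C₂ * N := by rw [hC₂]; ring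
    have h3 := norm_le_norm_add_norm_sub (I h) (I s)
    linarith
  have hlim := (hx hxΩ).norm
  have := le_of_tendsto hlim (by
    filter_upwards [Ioo_mem_nhdsGT hh] with s hs using hstep s hs)
  refine this.trans ?_
  nlinarith [mul_nonneg hC₁0 hN0, mul_nonneg hC₂0 hNf0]

/-- The Sobolev embedding `W^{1,q}(Ω) ⊆ L^∞(Ω)` for `q > 3`. -/
theorem exists_ae_norm_le_of_smoothBoundary {F : Type*} [NormedAddCommGroup F]
    [NormedSpace ℝ F] [CompleteSpace F] {Ω : Set E3} (hΩ : IsOpen Ω)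
    (hΩb : Bornology.IsBounded Ω) (hb : HasSmoothBoundary Ω) {q : ℝ} (hq : 3 < q) :
    ∃ C : ℝ, 0 ≤ C ∧ ∀ (f : E3 → F) (Df : E3 → (E3 →L[ℝ] F)), HasWeakFDeriv Ω f Df →
      MemLp f (ENNReal.ofReal q) (volume.restrict Ω) →
      MemLp Df (ENNReal.ofReal q) (volume.restrict Ω) →
      ∀ᵐ x ∂(volume.restrict Ω),
        ‖f x‖ ≤ C * ((eLpNorm f (ENNReal.ofReal q) (volume.restrict Ω)).toReal
          + (eLpNorm Df (ENNReal.ofReal q) (volume.restrict Ω)).toReal) := by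
  have hcl : IsCompact (closure Ω) := hΩb.isCompact_closure
  have hfin : volume Ω ≠ ⊤ := hΩb.measure_lt_top.ne
  have key := hcl.induction_on (p := fun S => ∃ C : ℝ, 0 ≤ C ∧
      ∀ (f : E3 → F) (Df : E3 → (E3 →L[ℝ] F)), HasWeakFDeriv Ω f Df →
      MemLp f (ENNReal.ofReal q) (volume.restrict Ω) →
      MemLp Df (ENNReal.ofReal q) (volume.restrict Ω) →
      ∀ᵐ x, x ∈ S → x ∈ Ω →
        ‖f x‖ ≤ C * ((eLpNorm f (ENNReal.ofReal q) (volume.restrict Ω)).toReal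
          + (eLpNorm Df (ENNReal.ofReal q) (volume.restrict Ω)).toReal))
    ⟨0, le_rfl, fun f Df _ _ _ => Eventually.of_forall fun x hx => absurd hx (by simp)⟩
    (fun S S' hS ⟨C, hC, hC'⟩ => ⟨C, hC, fun f Df h1 h2 h3 => by
      filter_upwards [hC' f Df h1 h2 h3] with x hx hxS using hx (hS hxS)⟩)
    (fun S S' ⟨C, hC, hC'⟩ ⟨D, hD, hD'⟩ => ⟨max C D, hC.trans (le_max_left _ _),
      fun f Df h1 h2 h3 => by
        filter_upwards [hC' f Df h1 h2 h3, hD' f Df h1 h2 h3] with x hx hx' hxS hxΩ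
        have h0 := add_nonneg
          (ENNReal.toReal_nonneg (a := eLpNorm f (ENNReal.ofReal q) (volume.restrict Ω)))
          (ENNReal.toReal_nonneg (a := eLpNorm Df (ENNReal.ofReal q) (volume.restrict Ω)))
        rcases hxS with hxS | hxS
        · exact (hx hxS hxΩ).trans (mul_le_mul_of_nonneg_right (le_max_left _ _) h0)
        · exact (hx' hxS hxΩ).trans (mul_le_mul_of_nonneg_right (le_max_right _ _) h0)⟩)
    (fun x₀ hx₀ => by
      obtain ⟨U, hU, ν, δ, h, hδ, hh, hcone⟩ := exists_cone_nhds hΩ hb hx₀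
      set b : ContDiffBump ν := ⟨δ / 2, δ, by positivity, half_lt_self hδ⟩ with hbdef
      obtain ⟨C, hC, hC'⟩ := exists_ae_norm_le_of_cone (F := F) hΩ hfin hq
        (ψ := b.normed volume) b.contDiff_normed b.hasCompactSupport_normed b.integral_normed hh
      refine ⟨U, mem_nhdsWithin_of_mem_nhds hU, C, hC, fun f Df h1 h2 h3 => ?_⟩
      filter_upwards [hC' f Df h1 h2 h3] with x hx hxU hxΩ
      refine hx hxΩ fun s hs z hz => hcone x hxU hxΩ s hs z ?_
      rwa [b.tsupport_normed_eq] at hz)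
  obtain ⟨C, hC, hC'⟩ := key
  refine ⟨C, hC, fun f Df h1 h2 h3 => ?_⟩
  rw [ae_restrict_iff' hΩ.measurableSet]
  filter_upwards [hC' f Df h1 h2 h3] with x hx hxΩ using hx (subset_closure hxΩ) hxΩ

/-! ### Weak time derivatives -/

open ContinuousLinearMap in
/-- A continuous function with continuous weak derivative `B` on `(0, T)` is a primitive of `B`
there. -/
theorem sub_eq_integral_of_weak_deriv {T : ℝ} {A B : ℝ → ℝ} (hA : Continuous A)
    (hB : Continuous B) {M : ℝ} (hM : ∀ t, |B t| ≤ M)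
    (hw : ∀ θ : ℝ → ℝ, ContDiff ℝ ∞ θ → HasCompactSupport θ → tsupport θ ⊆ Ioo 0 T →
      ∫ t in Ioo 0 T, deriv θ t * A t = - ∫ t in Ioo 0 T, θ t * B t)
    {a b : ℝ} (ha : 0 < a) (hab : a ≤ b) (hb : b < T) :
    A b - A a = ∫ t in a..b, B t := by
  set δ := min a (T - b) with hδ
  have hδ0 : 0 < δ := lt_min ha (by linarith)
  set η : ℕ → ContDiffBump (0 : ℝ) := fun n =>
    ⟨δ / (n + 2) / 2, δ / (n + 2), by positivity, half_lt_self (by positivity)⟩ with hη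
  have hη0 : Tendsto (fun n => (η n).rOut) atTop (𝓝 0) := by
    have := (tendsto_const_div_atTop_nhds_zero_nat δ).comp (tendsto_add_atTop_nat 2)
    refine this.congr fun n => ?_
    simp [hη]
  have hηδ : ∀ n, (η n).rOut < δ := fun n => by
    simp only [hη]
    exact div_lt_self hδ0 (by linarith [(Nat.cast_nonneg n : (0:ℝ) ≤ n)])
  set An : ℕ → ℝ → ℝ := fun n =>
    convolution ((η n).normed volume) A (lsmul ℝ ℝ) volume with hAn
  set Bn : ℕ → ℝ → ℝ := fun n =>
    convolution ((η n).normed volume) B (lsmul ℝ ℝ) volume with hBn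
  have hBc : ∀ n, Continuous (Bn n) := fun n =>
    (η n).hasCompactSupport_normed.continuous_convolution_left _
      ((η n).contDiff_normed (n := 0)).continuous hB.locallyIntegrable
  have hBM : ∀ n t, ‖Bn n t‖ ≤ M := by
    intro n t
    have h1 : ‖Bn n t‖ ≤ ∫ s, (η n).normed volume s * M := by
      refine norm_integral_le_of_norm_le ((η n).integrable_normed.mul_const M)
        (Eventually.of_forall fun s => ?_)
      simp only [lsmul_apply, smul_eq_mul]
      rw [norm_mul, Real.norm_of_nonneg ((η n).nonneg_normed s)]
      exact mul_le_mul_of_nonneg_left (hM _) ((η n).nonneg_normed s)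
    rwa [integral_mul_const, (η n).integral_normed, one_mul] at h1
  have hd : ∀ n, ∀ t ∈ Icc a b, HasDerivAt (An n) (Bn n t) t := by
    intro n t ht
    have hsm : ContDiff ℝ ∞ ((η n).normed (volume : Measure ℝ)) := (η n).contDiff_normed
    have hcs : HasCompactSupport ((η n).normed (volume : Measure ℝ)) :=
      (η n).hasCompactSupport_normed
    have h1 := hcs.hasDerivAt_convolution_left (μ := volume) (lsmul ℝ ℝ)
      (hsm.of_le (by exact_mod_cast le_top)) hA.locallyIntegrable t
    refine h1.congr_deriv ?_
    set θ : ℝ → ℝ := fun s => (η n).normed volume (t - s) with hθ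
    have hθs : ContDiff ℝ ∞ θ := hsm.comp (contDiff_const.sub contDiff_id)
    have hθd : ∀ s, deriv θ s = - deriv ((η n).normed volume) (t - s) := fun s =>
      deriv_comp_const_sub _ t s
    have hts : tsupport θ ⊆ Metric.closedBall t (η n).rOut := by
      refine closure_minimal (fun y hy => ?_) Metric.isClosed_closedBall
      have : t - y ∈ Function.support ((η n).normed (volume : Measure ℝ)) := hy
      rw [(η n).support_normed_eq, mem_ball_zero_iff] at this
      rw [Metric.mem_closedBall, dist_comm, dist_eq_norm]
      exact le_of_lt this
    have hts' : tsupport θ ⊆ Ioo 0 T := by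
      refine hts.trans fun y hy => ?_
      rw [Real.closedBall_eq_Icc] at hy
      have h2 := hηδ n
      have h3 := min_le_left a (T - b)
      have h4 := min_le_right a (T - b)
      exact ⟨by linarith [hy.1, ht.1], by linarith [hy.2, ht.2]⟩
    have hθc : HasCompactSupport θ :=
      (isCompact_closedBall t _).of_isClosed_subset (isClosed_tsupport _) hts
    have := hw θ hθs hθc hts'
    rw [setIntegral_eq_integral_of_forall_compl_eq_zero fun s hs => ?_,
      setIntegral_eq_integral_of_forall_compl_eq_zero fun s hs => ?_] at this
    · change _ = convolution ((η n).normed volume) B (lsmul ℝ ℝ) volume t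
      rw [convolution_eq_swap, convolution_lsmul_swap]
      simp only [lsmul_apply, smul_eq_mul]
      rw [← neg_inj, ← this, ← integral_neg]
      congr 1; ext s
      rw [hθd]; ring
    · rw [image_eq_zero_of_notMem_tsupport fun h => hs (hts' h), zero_mul]
    · rw [image_eq_zero_of_notMem_tsupport (f := deriv θ)
        fun h => hs (hts' (tsupport_deriv_subset h)), zero_mul]
  have hftc : ∀ n, ∫ t in a..b, Bn n t = An n b - An n a := fun n =>
    intervalIntegral.integral_eq_sub_of_hasDerivAt
      (fun t ht => hd n t (by rwa [uIcc_of_le hab] at ht)) ((hBc n).intervalIntegrable _ _)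
  have l1 : Tendsto (fun n => An n b - An n a) atTop (𝓝 (A b - A a)) :=
    (ContDiffBump.convolution_tendsto_right_of_continuous hη0 hA b).sub
      (ContDiffBump.convolution_tendsto_right_of_continuous hη0 hA a)
  have l2 : Tendsto (fun n => ∫ t in a..b, Bn n t) atTop (𝓝 (∫ t in a..b, B t)) :=
    intervalIntegral.tendsto_integral_filter_of_dominated_convergence (fun _ => M)
      (Eventually.of_forall fun n => (hBc n).aestronglyMeasurable)
      (Eventually.of_forall fun n => Eventually.of_forall fun t _ => hBM n t)
      intervalIntegrable_const
      (Eventually.of_forall fun t _ =>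
        ContDiffBump.convolution_tendsto_right_of_continuous hη0 hB t)
  exact tendsto_nhds_unique l1 (l2.congr hftc)

section

variable {F : Type*} [NormedAddCommGroup F]

theorem MemCLp.mono_exponent [NormedSpace ℝ F] {Ω : Set E3} (hΩ : volume Ω ≠ ⊤) {T : ℝ}
    {p q : ℝ≥0∞} (hp : p ≠ 0) (hpq : p ≤ q) {f : ℝ → E3 → F} (hf : MemCLp Ω T q f) :
    MemCLp Ω T p f := by
  have hfin : IsFiniteMeasure (volume.restrict Ω) := ⟨by simpa using hΩ.lt_top⟩
  refine ⟨hf.1, fun t ht => (hf.2.1 t ht).mono_exponent hpq, fun t ht => ?_⟩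
  set c := (volume.restrict Ω) univ ^ (1 / p.toReal - 1 / q.toReal) with hc
  by_cases hpt : p = ⊤
  · have : q = p := by rw [hpt] at hpq ⊢; exact top_le_iff.1 hpq
    rw [← this]; exact hf.2.2 t ht
  have hexp : 0 ≤ 1 / p.toReal - 1 / q.toReal := by
    by_cases hq : q = ⊤
    · rw [hq]; simp
    · rw [sub_nonneg]
      exact one_div_le_one_div_of_le (ENNReal.toReal_pos hp hpt) (ENNReal.toReal_mono hq hpq)
  have hct : c ≠ ⊤ := ENNReal.rpow_ne_top_of_nonneg hexp (measure_ne_top _ _)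
  have h1 := ENNReal.Tendsto.mul_const (b := c) (hf.2.2 t ht) (Or.inr hct)
  rw [zero_mul] at h1
  refine tendsto_of_tendsto_of_tendsto_of_le_of_le' tendsto_const_nhds h1
    (Eventually.of_forall fun _ => zero_le) ?_
  filter_upwards [self_mem_nhdsWithin] with s hs
  exact eLpNorm_le_eLpNorm_mul_rpow_measure_univ hpq ((hf.2.1 s hs).sub (hf.2.1 t ht)).1

/-- A function in `C([0,T]; L^p(Ω))` agrees on `[0,T]` with a bounded continuous map from `ℝ` to
`L^p(Ω)`: outside `[0,T]` it is extended by its values at the end points. -/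
theorem MemCLp.exists_continuous_lp [NormedSpace ℝ F] {Ω : Set E3} {T : ℝ} (hT : 0 ≤ T)
    {p : ℝ≥0∞} [Fact (1 ≤ p)] {f : ℝ → E3 → F} (hf : MemCLp Ω T p f) :
    ∃ R : ℝ → Lp F p (volume.restrict Ω), Continuous R ∧ (∃ M, ∀ t, ‖R t‖ ≤ M) ∧
      ∀ t ∈ Icc 0 T, R t =ᵐ[volume.restrict Ω] f t := by
  set r : Icc 0 T → Lp F p (volume.restrict Ω) := fun t => (hf.2.1 t t.2).toLp with hr
  have hrc : Continuous r := by
    rw [continuous_iff_continuousAt]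
    intro t
    rw [ContinuousAt, tendsto_iff_edist_tendsto_0]
    have h1 : Tendsto (fun s : Icc 0 T => (s : ℝ)) (𝓝 t) (𝓝[Icc 0 T] (t : ℝ)) :=
      tendsto_nhdsWithin_iff.2 ⟨continuous_subtype_val.tendsto t,
        Eventually.of_forall fun s => s.2⟩
    refine ((hf.2.2 t t.2).comp h1).congr fun s => ?_
    rw [hr, Lp.edist_toLp_toLp]
    rfl
  refine ⟨IccExtend hT r, hrc.Icc_extend', ?_, fun t ht => ?_⟩
  · obtain ⟨M, hM⟩ := (isCompact_range hrc).isBounded.exists_norm_le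
    exact ⟨M, fun t => hM _ ⟨_, rfl⟩⟩
  · rw [IccExtend_of_mem hT r ht]
    exact MemLp.coeFn_toLp _

end

/-- If `f` and its weak time derivative `ft` are in `C([0,T]; L²(Ω))`, then `ft` is the derivative
of `f` as a map into `L²(Ω)`. -/
theorem exists_hasDerivAt_lp {Ω : Set E3} (hΩ : IsOpen Ω) (hΩf : volume Ω ≠ ⊤) {T : ℝ}
    (hT : 0 ≤ T) {f ft : ℝ → E3 → ℝ} (hf : MemCLp Ω T 2 f) (hft : MemCLp Ω T 2 ft)
    (hw : HasWeakTimeDeriv Ω T f ft) :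
    ∃ R R' : ℝ → Lp ℝ 2 (volume.restrict Ω), Continuous R ∧ Continuous R' ∧
      (∀ t ∈ Icc 0 T, R t =ᵐ[volume.restrict Ω] f t) ∧
      (∀ t ∈ Icc 0 T, R' t =ᵐ[volume.restrict Ω] ft t) ∧
      ∀ t ∈ Ioo 0 T, HasDerivAt R (R' t) t := by
  have hfin : IsFiniteMeasure (volume.restrict Ω) := ⟨by simpa using hΩf.lt_top⟩
  obtain ⟨R, hRc, -, hR⟩ := hf.exists_continuous_lp hT
  obtain ⟨R', hRc', ⟨M, hM⟩, hR'⟩ := hft.exists_continuous_lp hT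
  refine ⟨R, R', hRc, hRc', hR, hR', ?_⟩
  have key : ∀ a b, 0 < a → a ≤ b → b < T → R b = R a + ∫ t in a..b, R' t := by
    intro a b ha hab hb
    set g := R b - R a - ∫ t in a..b, R' t with hg
    have hgi : IntegrableOn g Ω := (Lp.memLp g).integrable (by norm_num)
    have hzero : ∀ χ : E3 → ℝ, ContDiff ℝ ∞ χ → HasCompactSupport χ → tsupport χ ⊆ Ω →
        ∫ x, χ x • g x = 0 := by
      intro χ hχ hχc hχΩ
      have hχL : MemLp χ 2 (volume.restrict Ω) :=
        (hχ.continuous.memLp_of_hasCompactSupport hχc).restrict Ω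
      set X := hχL.toLp with hX
      have hinner : ∀ r : Lp ℝ 2 (volume.restrict Ω), inner ℝ X r = ∫ x in Ω, χ x * r x := by
        intro r
        rw [L2.inner_def]
        refine integral_congr_ae ?_
        filter_upwards [hχL.coeFn_toLp] with x hx
        rw [hx]; simp [mul_comm]
      rw [← setIntegral_eq_integral_of_forall_compl_eq_zero (s := Ω) fun x hx => by
        rw [image_eq_zero_of_notMem_tsupport fun h => hx (hχΩ h), zero_smul]]
      have h1 := hinner g
      simp only [smul_eq_mul]
      rw [← h1, hg, inner_sub_right, inner_sub_right]
      have h2 : inner ℝ X (∫ t in a..b, R' t) = ∫ t in a..b, inner ℝ X (R' t) :=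
        ((innerSL ℝ X).intervalIntegral_comp_comm (hRc'.intervalIntegrable a b)).symm
      rw [h2, sub_eq_zero]
      refine sub_eq_integral_of_weak_deriv (T := T) (M := ‖X‖ * M)
        (A := fun t => inner ℝ X (R t)) (B := fun t => inner ℝ X (R' t))
        (by fun_prop) (by fun_prop)
        (fun t => (abs_real_inner_le_norm _ _).trans (by gcongr; exact hM t)) ?_ ha hab hb
      intro θ hθ hθc hθT
      set φ : ℝ × E3 → ℝ := fun z => θ z.1 * χ z.2 with hφ
      have hφs : ContDiff ℝ ∞ φ := (hθ.comp contDiff_fst).mul (hχ.comp contDiff_snd)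
      have hts : tsupport φ ⊆ tsupport θ ×ˢ tsupport χ := by
        refine closure_minimal (fun z hz => ?_)
          ((isClosed_tsupport _).prod (isClosed_tsupport _))
        exact ⟨subset_tsupport _ (left_ne_zero_of_mul hz),
          subset_tsupport _ (right_ne_zero_of_mul hz)⟩
      have hφc : HasCompactSupport φ :=
        (hθc.isCompact.prod hχc.isCompact).of_isClosed_subset (isClosed_tsupport _) hts
      have h3 := hw φ hφs hφc (hts.trans (prod_mono hθT hχΩ))
      have hφd : ∀ t x, fderiv ℝ φ (t, x) (1, 0) = deriv θ t * χ x := by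
        intro t x
        have h4 : HasFDerivAt φ _ (t, x) :=
          (((hθ.differentiable (by simp) t).hasDerivAt.hasFDerivAt).comp (t, x)
            (hasFDerivAt_fst (𝕜 := ℝ) (p := (t, x)))).mul
          (((hχ.differentiable (by simp) x).hasFDerivAt).comp (t, x)
            (hasFDerivAt_snd (𝕜 := ℝ) (p := (t, x))))
        rw [h4.fderiv]
        simp [mul_comm]
      have e1 : ∀ t ∈ Ioo 0 T, ∫ x in Ω, fderiv ℝ φ (t, x) (1, 0) • f t x
          = deriv θ t * inner ℝ X (R t) := by
        intro t ht
        rw [hinner, ← integral_const_mul]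
        refine integral_congr_ae ?_
        filter_upwards [hR t (Ioo_subset_Icc_self ht)] with x hx
        rw [hx, hφd, smul_eq_mul]; ring
      have e2 : ∀ t ∈ Ioo 0 T, ∫ x in Ω, φ (t, x) • ft t x
          = θ t * inner ℝ X (R' t) := by
        intro t ht
        rw [hinner, ← integral_const_mul]
        refine integral_congr_ae ?_
        filter_upwards [hR' t (Ioo_subset_Icc_self ht)] with x hx
        rw [hx, smul_eq_mul]; ring
      rwa [setIntegral_congr_fun measurableSet_Ioo e1,
        setIntegral_congr_fun measurableSet_Ioo e2] at h3
    have h0 := hΩ.ae_eq_zero_of_integral_contDiff_smul_eq_zero hgi.locallyIntegrableOn hzero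
    have hg0 : g = 0 := by
      rw [Lp.eq_zero_iff_ae_eq_zero]
      exact (ae_restrict_iff' hΩ.measurableSet).2 h0
    rw [hg, sub_sub, sub_eq_zero] at hg0
    exact hg0
  intro t ht
  have h1 : HasDerivAt (fun s => R (t / 2) + ∫ τ in (t / 2)..s, R' τ) (R' t) t :=
    ((hRc'.integral_hasStrictDerivAt (t / 2) t).hasDerivAt).const_add _
  refine h1.congr_of_eventuallyEq ?_
  have ht0 : t / 2 < t := half_lt_self ht.1
  filter_upwards [Ioo_mem_nhds ht0 ht.2] with s hs
  exact key (t / 2) s (half_pos ht.1) hs.1.le hs.2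

/-! ### Integral functionals and regularized negative powers -/

section

variable {α : Type*} [MeasurableSpace α] {μ : Measure α}

theorem abs_sub_sub_deriv_mul_le {f : ℝ → ℝ} (hf : Differentiable ℝ f) {L : NNReal}
    (hL : LipschitzWith L (deriv f)) (a b : ℝ) :
    |f b - f a - deriv f a * (b - a)| ≤ L * (b - a) ^ 2 := by
  have h := (convex_uIcc a b).norm_image_sub_le_of_norm_hasDerivWithin_le
    (f := fun r => f r - deriv f a * r) (f' := fun r => deriv f r - deriv f a) (C := L * |b - a|)
    (fun r _ => ((hf r).hasDerivAt.sub
      (by simpa using (hasDerivAt_id r).const_mul (deriv f a))).hasDerivWithinAt)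
    (fun r hr => by
      have h1 := hL.dist_le_mul r a
      rw [Real.dist_eq, Real.dist_eq] at h1
      refine h1.trans ?_
      have := abs_sub_left_of_mem_uIcc hr
      gcongr) left_mem_uIcc right_mem_uIcc
  rw [Real.norm_eq_abs, Real.norm_eq_abs] at h
  calc |f b - f a - deriv f a * (b - a)| = |f b - deriv f a * b - (f a - deriv f a * a)| := by
        congr 1; ring
    _ ≤ L * |b - a| * |b - a| := h
    _ = L * (b - a) ^ 2 := by rw [mul_assoc, abs_mul_abs_self]; ring

/-- The functional `r ↦ ∫ f(r)` is Fréchet differentiable on `L²`, with gradient `f'(r)`; it is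
`f' 0 = 0` that makes `f' ∘ r` available as `LipschitzWith.compLp`. -/
theorem hasFDerivAt_integral_comp_lp [IsFiniteMeasure μ] {f : ℝ → ℝ} (hf : Differentiable ℝ f)
    {C : ℝ} (hC : ∀ r, |f r| ≤ C) {L : NNReal} (hL : LipschitzWith L (deriv f))
    (h0 : deriv f 0 = 0) (r : Lp ℝ 2 μ) :
    HasFDerivAt (fun r : Lp ℝ 2 μ => ∫ x, f (r x) ∂μ) (innerSL ℝ (hL.compLp h0 r)) r := by
  have hfi : ∀ s : Lp ℝ 2 μ, Integrable (fun x => f (s x)) μ := fun s =>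
    Integrable.of_bound (hf.continuous.comp_aestronglyMeasurable (Lp.aestronglyMeasurable s)) C
      (Eventually.of_forall fun x => hC _)
  rw [hasFDerivAt_iff_isLittleO_nhds_zero]
  refine Asymptotics.IsBigO.trans_isLittleO (g := fun h : Lp ℝ 2 μ => ‖h‖ ^ 2) ?_
    (Asymptotics.isLittleO_norm_pow_id one_lt_two)
  refine Asymptotics.IsBigO.of_bound L (Eventually.of_forall fun h => ?_)
  have hi : Integrable (fun x => inner ℝ (hL.compLp h0 r x) (h x)) μ := L2.integrable_inner _ _
  have hsq : Integrable (fun x => inner ℝ (h x) (h x)) μ := L2.integrable_inner _ _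
  have e1 : (∫ x, f ((r + h) x) ∂μ) - (∫ x, f (r x) ∂μ) - innerSL ℝ (hL.compLp h0 r) h
      = ∫ x, (f ((r + h) x) - f (r x) - inner ℝ (hL.compLp h0 r x) (h x)) ∂μ := by
    rw [innerSL_apply_apply, L2.inner_def, ← integral_sub (hfi _) (hfi _)]
    exact (integral_sub ((hfi _).sub (hfi _)) hi).symm
  have e2 : ‖h‖ ^ 2 = ∫ x, inner ℝ (h x) (h x) ∂μ := by
    rw [← real_inner_self_eq_norm_sq, L2.inner_def]
  rw [e1, Real.norm_of_nonneg (sq_nonneg _), e2, ← integral_const_mul]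
  refine norm_integral_le_of_norm_le (hsq.const_mul _) ?_
  filter_upwards [Lp.coeFn_add r h, hL.coeFn_compLp h0 r] with x hx1 hx2
  rw [hx1, hx2, Function.comp_apply, Pi.add_apply]
  have := abs_sub_sub_deriv_mul_le hf hL (r x) (r x + h x)
  rw [add_sub_cancel_left] at this
  rw [Real.norm_eq_abs]
  convert this using 2
  · simp [mul_comm]
  · simp [pow_two]

end

/-- The function `(r ^ 2 + ε) ^ (-p)`: a smooth bounded version of `r ^ (-2 p)`. -/
def regInvPow (ε : ℝ) (p : ℕ) (r : ℝ) : ℝ := ((r ^ 2 + ε) ^ p)⁻¹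

theorem regInvPow_pos {ε : ℝ} (hε : 0 < ε) (p : ℕ) (r : ℝ) : 0 < regInvPow ε p r := by
  unfold regInvPow; positivity

theorem contDiff_regInvPow {ε : ℝ} (hε : 0 < ε) (p : ℕ) : ContDiff ℝ ∞ (regInvPow ε p) := by
  unfold regInvPow
  refine ContDiff.inv (by fun_prop) fun r => ?_
  positivity

theorem hasDerivAt_regInvPow {ε : ℝ} (hε : 0 < ε) (p : ℕ) (r : ℝ) :
    HasDerivAt (regInvPow ε p) (-(2 * p * r * regInvPow ε (p + 1) r)) r := by
  have h1 : HasDerivAt (fun r : ℝ => r ^ 2 + ε) (2 * r) r := by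
    simpa using (hasDerivAt_pow 2 r).add_const ε
  have hpos : 0 < r ^ 2 + ε := by positivity
  have h2 : HasDerivAt (fun r : ℝ => ((r ^ 2 + ε) ^ p)⁻¹) _ r :=
    (h1.pow p).inv (pow_ne_zero p hpos.ne')
  refine HasDerivAt.congr_deriv h2 ?_
  unfold regInvPow
  rcases p with _ | p
  · simp
  · simp only [Nat.add_sub_cancel]
    push_cast
    change _ / ((r ^ 2 + ε) ^ (p + 1)) ^ 2 = _
    field_simp
    ring

theorem regInvPow_le {ε : ℝ} (hε : 0 < ε) (p : ℕ) (r : ℝ) :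
    regInvPow ε p r ≤ (ε ^ p)⁻¹ := by
  unfold regInvPow
  gcongr
  nlinarith [sq_nonneg r]

theorem regInvPow_succ {ε : ℝ} (p : ℕ) (r : ℝ) :
    regInvPow ε (p + 1) r = regInvPow ε p r * (r ^ 2 + ε)⁻¹ := by
  unfold regInvPow
  rw [pow_succ, mul_inv]

/-- The bound `|r f'(r)| ≤ 2 p f(r)`, uniform in `ε`, which closes the Gronwall estimate. -/
theorem abs_mul_deriv_regInvPow_le {ε : ℝ} (hε : 0 < ε) (p : ℕ) (r : ℝ) :
    |r * deriv (regInvPow ε p) r| ≤ 2 * p * regInvPow ε p r := by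
  rw [(hasDerivAt_regInvPow hε p r).deriv, mul_neg, abs_neg, regInvPow_succ]
  have h0 := regInvPow_pos hε p r
  have hpos : 0 < r ^ 2 + ε := by positivity
  rw [show r * (2 * p * r * (regInvPow ε p r * (r ^ 2 + ε)⁻¹))
    = 2 * p * regInvPow ε p r * (r ^ 2 * (r ^ 2 + ε)⁻¹) by ring, abs_of_nonneg (by positivity)]
  refine mul_le_of_le_one_right (by positivity) ?_
  rw [mul_inv_le_iff₀ hpos]
  linarith

theorem deriv_regInvPow_zero {ε : ℝ} (hε : 0 < ε) (p : ℕ) : deriv (regInvPow ε p) 0 = 0 := by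
  rw [(hasDerivAt_regInvPow hε p 0).deriv]; simp

theorem exists_bound_deriv_regInvPow {ε : ℝ} (hε : 0 < ε) (p : ℕ) :
    ∃ C : ℝ, ∀ r, |deriv (regInvPow ε p) r| ≤ C := by
  refine ⟨2 * p * ((ε ^ p)⁻¹ * (1 + ε⁻¹)), fun r => ?_⟩
  have hpos : 0 < r ^ 2 + ε := by positivity
  have h0 := regInvPow_pos hε p r
  have h1 : |r| * (r ^ 2 + ε)⁻¹ ≤ 1 + ε⁻¹ := by
    rw [mul_inv_le_iff₀ hpos]
    have h2 : |r| ≤ r ^ 2 + 1 := by nlinarith [sq_abs r, sq_nonneg (|r| - 1)]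
    have h3 : ε⁻¹ * ε = 1 := inv_mul_cancel₀ hε.ne'
    have h4 : 0 < ε⁻¹ := inv_pos.2 hε
    nlinarith [mul_nonneg h4.le (sq_nonneg r)]
  rw [(hasDerivAt_regInvPow hε p r).deriv, abs_neg, regInvPow_succ, abs_mul, abs_mul, abs_mul,
    abs_of_pos (mul_pos h0 (inv_pos.2 hpos)), Nat.abs_cast, abs_two]
  calc 2 * p * |r| * (regInvPow ε p r * (r ^ 2 + ε)⁻¹)
      = 2 * p * (regInvPow ε p r * (|r| * (r ^ 2 + ε)⁻¹)) := by ring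
    _ ≤ _ := by gcongr; exact regInvPow_le hε p r

theorem exists_lipschitzWith_deriv_regInvPow {ε : ℝ} (hε : 0 < ε) (p : ℕ) :
    ∃ L : NNReal, LipschitzWith L (deriv (regInvPow ε p)) := by
  have hd : deriv (regInvPow ε p) = fun r => -(2 * p * r * regInvPow ε (p + 1) r) :=
    funext fun r => (hasDerivAt_regInvPow hε p r).deriv
  have h2 : ∀ r, HasDerivAt (fun r => -(2 * p * r * regInvPow ε (p + 1) r))
      (-(2 * p * regInvPow ε (p + 1) r + 2 * p * (r * deriv (regInvPow ε (p + 1)) r))) r := by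
    intro r
    have h3 := ((((hasDerivAt_id r).const_mul (2 * (p : ℝ))).mul
      (hasDerivAt_regInvPow hε (p + 1) r)).neg)
    refine HasDerivAt.congr_deriv h3 ?_
    rw [(hasDerivAt_regInvPow hε (p + 1) r).deriv]
    simp only [id]; ring
  set K : ℝ := 2 * p * (ε ^ (p + 1))⁻¹ + 2 * p * (2 * (p + 1 : ℕ) * (ε ^ (p + 1))⁻¹) with hK
  have hK0 : 0 ≤ K := by positivity
  refine ⟨K.toNNReal, ?_⟩
  rw [hd]
  refine lipschitzWith_of_nnnorm_deriv_le (fun r => (h2 r).differentiableAt) fun r => ?_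
  rw [← NNReal.coe_le_coe, coe_nnnorm, Real.coe_toNNReal _ hK0, (h2 r).deriv, norm_neg]
  refine (norm_add_le _ _).trans ?_
  have h4 := abs_mul_deriv_regInvPow_le hε (p + 1) r
  have h5 := regInvPow_le hε (p + 1) r
  have h6 := regInvPow_pos hε (p + 1) r
  rw [norm_mul (2 * (p : ℝ)), norm_mul (2 * (p : ℝ)), Real.norm_eq_abs (r * _),
    Real.norm_of_nonneg h6.le, Real.norm_of_nonneg (by positivity : (0:ℝ) ≤ 2 * p), hK]
  gcongr
  exact h4.trans (by gcongr)

/-! ### Negative moments of the density -/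

theorem MemLpLp.integrable_toReal_eLpNorm {F : Type*} [NormedAddCommGroup F] [NormedSpace ℝ F]
    {Ω : Set E3} {T : ℝ} {q : ℝ} (hq : 0 < q) {f : ℝ → E3 → F}
    (hf : MemLpLp Ω T 2 (ENNReal.ofReal q) f) :
    (∀ᵐ t ∂(volume.restrict (Ioo 0 T)),
      eLpNorm (f t) (ENNReal.ofReal q) (volume.restrict Ω) < ⊤) ∧
    IntegrableOn (fun t => (eLpNorm (f t) (ENNReal.ofReal q) (volume.restrict Ω)).toReal)
      (Ioo 0 T) := by
  set N : ℝ → ℝ≥0∞ := fun t => eLpNorm (f t) (ENNReal.ofReal q) (volume.restrict Ω) with hN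
  have hNm : AEMeasurable N (volume.restrict (Ioo 0 T)) := by
    have h1 : AEMeasurable (fun z : ℝ × E3 => ‖f z.1 z.2‖ₑ ^ q)
        ((volume.restrict (Ioo 0 T)).prod (volume.restrict Ω)) :=
      hf.1.enorm.pow_const q
    have h2 := h1.lintegral_prod_right'.pow_const (1 / q)
    refine h2.congr (Eventually.of_forall fun t => ?_)
    simp only [hN]
    rw [eLpNorm_eq_lintegral_rpow_enorm_toReal (by simpa using hq) ENNReal.ofReal_ne_top,
      ENNReal.toReal_ofReal hq.le]
  have h1 : ∫⁻ t in Ioo 0 T, N t ≠ ⊤ := by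
    have h2 := eLpNorm_le_eLpNorm_mul_rpow_measure_univ (μ := volume.restrict (Ioo 0 T))
      (p := 1) (q := 2) one_le_two hNm.aestronglyMeasurable
    rw [eLpNorm_one_eq_lintegral_enorm] at h2
    simp only [enorm_eq_self] at h2
    refine (h2.trans_lt (ENNReal.mul_lt_top hf.2 ?_)).ne
    refine ENNReal.rpow_lt_top_of_nonneg (by norm_num) ?_
    simp
  exact ⟨ae_lt_top' hNm h1, integrable_toReal_of_lintegral_ne_top hNm h1⟩

theorem abs_divOf_le (A : E3 →L[ℝ] E3) : |divOf A| ≤ 3 * ‖A‖ := by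
  have h : ∀ i : Fin 3, |A (e i) i| ≤ ‖A‖ := fun i => by
    have h1 := PiLp.norm_apply_le (A (e i)) i
    have h2 := A.le_opNorm (e i)
    rw [show ‖e i‖ = 1 by simp [e], mul_one] at h2
    exact h1.trans h2
  calc |divOf A| ≤ ∑ i : Fin 3, |A (e i) i| := Finset.abs_sum_le_sum_abs _ _
    _ ≤ ∑ _i : Fin 3, ‖A‖ := Finset.sum_le_sum fun i _ => h i
    _ = 3 * ‖A‖ := by simp

theorem continuous_divOf : Continuous fun A : E3 →L[ℝ] E3 => divOf A := by
  unfold divOf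
  fun_prop

/-- Gronwall's inequality, backwards in time, for a positive function whose derivative satisfies the
bound only almost everywhere. -/
theorem gronwall_integral_le {y y' d : ℝ → ℝ} {T K : ℝ} (hT : 0 ≤ T) (hy : Continuous y)
    (hy' : Continuous y') (hpos : ∀ t, 0 < y t) (hd : ∀ t ∈ Ioo 0 T, HasDerivAt y (y' t) t)
    (hdi : IntegrableOn d (Ioo 0 T))
    (hle : ∀ᵐ t ∂(volume.restrict (Ioo 0 T)), |y' t| ≤ K * d t * y t) :
    y 0 ≤ y T * Real.exp (K * ∫ t in Ioo 0 T, d t) := by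
  have hc : Continuous fun t => y' t / y t := hy'.div hy fun t => (hpos t).ne'
  have h1 : ∫ t in (0:ℝ)..T, y' t / y t = Real.log (y T) - Real.log (y 0) :=
    intervalIntegral.integral_eq_sub_of_hasDerivAt_of_le hT
      (hy.log fun t => (hpos t).ne').continuousOn
      (fun t ht => (hd t ht).log (hpos t).ne') (hc.intervalIntegrable _ _)
  rw [intervalIntegral.integral_of_le hT, integral_Ioc_eq_integral_Ioo] at h1
  have h2 : -(K * ∫ t in Ioo 0 T, d t) ≤ ∫ t in Ioo 0 T, y' t / y t := by
    rw [← integral_const_mul, ← integral_neg]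
    refine integral_mono_ae (hdi.const_mul K).neg
      (hc.integrableOn_Icc.mono_set Ioo_subset_Icc_self) ?_
    filter_upwards [hle] with t ht
    rw [le_div_iff₀ (hpos t)]
    have := neg_abs_le (y' t)
    linarith
  rw [h1] at h2
  rw [← Real.log_le_log_iff (hpos 0) (mul_pos (hpos T) (Real.exp_pos _)),
    Real.log_mul (hpos T).ne' (Real.exp_pos _).ne', Real.log_exp]
  linarith

section

variable {Ω : Set E3} {γ mu lam T q : ℝ}
    {ρ : ℝ → E3 → ℝ} {u : ℝ → E3 → E3}
    {Dρ : ℝ → E3 → (E3 →L[ℝ] ℝ)} {ρt : ℝ → E3 → ℝ}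
    {Du : ℝ → E3 → (E3 →L[ℝ] E3)} {D2u : ℝ → E3 → (E3 →L[ℝ] E3 →L[ℝ] E3)}
    {ut : ℝ → E3 → E3} {Dut : ℝ → E3 → (E3 →L[ℝ] E3)}

/-- `div u ∈ L¹(0,T; L^∞(Ω))`. -/
theorem IsStrongSolutionWith.exists_divergence_bound (hΩ : IsSmoothSimplyConnectedDomain Ω)
    (h : IsStrongSolutionWith Ω γ mu lam T q ρ u Dρ ρt Du D2u ut Dut) :
    ∃ d : ℝ → ℝ, IntegrableOn d (Ioo 0 T) ∧
      ∀ᵐ t ∂(volume.restrict (Ioo 0 T)), ∀ᵐ x ∂(volume.restrict Ω), |divOf (Du t x)| ≤ d t := by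
  have hq0 : 0 < q := by linarith [h.q_gt]
  obtain ⟨C, hC, hCb⟩ := exists_ae_norm_le_of_smoothBoundary (F := E3 →L[ℝ] E3) hΩ.isOpen
    hΩ.isBounded hΩ.smoothBoundary h.q_gt
  obtain ⟨h1, h1'⟩ := h.Du_L2.integrable_toReal_eLpNorm hq0
  obtain ⟨h2, h2'⟩ := h.D2u_L2.integrable_toReal_eLpNorm hq0
  refine ⟨_, ((h1'.add h2').const_mul C).const_mul 3, ?_⟩
  filter_upwards [h1, h2, ae_restrict_mem measurableSet_Ioo] with t ht1 ht2 ht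
  have hw := h.weakDeriv_Du t (Ioo_subset_Icc_self ht)
  filter_upwards [hCb (Du t) (D2u t) hw ⟨hw.1.aestronglyMeasurable, ht1⟩
    ⟨hw.2.1.aestronglyMeasurable, ht2⟩] with x hx
  exact (abs_divOf_le _).trans (by gcongr; exact hx)

/-- The renormalized continuity equation `∂ₜ f(ρ) + div (f(ρ) u) = (f(ρ) - ρ f'(ρ)) div u`,
integrated over `Ω`. The flux term vanishes by the boundary condition `u · n = 0`, tested with `f(ρ) ∈ H¹`. -/
theorem IsStrongSolutionWith.ae_integral_deriv_mul_eq (hΩ : IsSmoothSimplyConnectedDomain Ω)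
    (h : IsStrongSolutionWith Ω γ mu lam T q ρ u Dρ ρt Du D2u ut Dut)
    {f : ℝ → ℝ} (hf : ContDiff ℝ 1 f) {C : ℝ} (hfC : ∀ r, |f r| ≤ C)
    (hfC' : ∀ r, |deriv f r| ≤ C) :
    ∀ᵐ t ∂(volume.restrict (Ioo 0 T)),
      ∫ x in Ω, deriv f (ρ t x) * ρt t x
        = ∫ x in Ω, (f (ρ t x) - ρ t x * deriv f (ρ t x)) * divOf (Du t x) := by
  have hΩf : volume Ω ≠ ⊤ := hΩ.isBounded.measure_lt_top.ne
  have hfin : IsFiniteMeasure (volume.restrict Ω) := ⟨by simpa using hΩf.lt_top⟩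
  have hq2 : (2 : ℝ≥0∞) ≤ ENNReal.ofReal q := by
    simpa using ENNReal.ofReal_le_ofReal (by linarith [h.q_gt] : (2 : ℝ) ≤ q)
  have hmass : ∀ᵐ t ∂(volume.restrict (Ioo 0 T)), ∀ᵐ x ∂(volume.restrict Ω),
      ρt t x + (Dρ t x (u t x) + ρ t x * divOf (Du t x)) = 0 :=
    Measure.ae_ae_of_ae_prod h.mass
  filter_upwards [hmass, ae_restrict_mem measurableSet_Ioo] with t hm ht
  have ht' := Ioo_subset_Icc_self ht
  have hf'c : Continuous (deriv f) := hf.continuous_deriv le_rfl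
  have hρ2 : MemLp (ρ t) 2 (volume.restrict Ω) := (h.rho_C.2.1 t ht').mono_exponent hq2
  have hDρ2 : MemLp (Dρ t) 2 (volume.restrict Ω) := (h.Drho_C.2.1 t ht').mono_exponent hq2
  have hρt2 : MemLp (ρt t) 2 (volume.restrict Ω) := (h.rhot_C.2.1 t ht').mono_exponent hq2
  have hu2 := h.u_C.2.1 t ht'
  have hDu2 := h.Du_C.2.1 t ht'
  have hfm : AEStronglyMeasurable (fun x => f (ρ t x)) (volume.restrict Ω) :=
    hf.continuous.comp_aestronglyMeasurable hρ2.1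
  have hf'm : AEStronglyMeasurable (fun x => deriv f (ρ t x)) (volume.restrict Ω) :=
    hf'c.comp_aestronglyMeasurable hρ2.1
  have hH1 : MemH1 Ω (fun x => f (ρ t x)) (fun x => deriv f (ρ t x) • Dρ t x) := by
    refine ⟨(h.weakDeriv_rho t ht').comp_contDiff hΩ.isOpen hf hfC hfC',
      MemLp.of_bound hfm C (Eventually.of_forall fun x => hfC _), ?_⟩
    refine MemLp.of_le_mul (c := C) hDρ2 (hf'm.smul hDρ2.1) (Eventually.of_forall fun x => ?_)
    rw [norm_smul]
    gcongr
    exact hfC' _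
  have hbc := h.normal_bc t ⟨ht.1, ht.2.le⟩ _ _ hH1
  have hDiv : MemLp (fun x => divOf (Du t x)) 2 (volume.restrict Ω) :=
    MemLp.of_le_mul (c := 3) hDu2 (continuous_divOf.comp_aestronglyMeasurable hDu2.1)
      (Eventually.of_forall fun x => abs_divOf_le _)
  have hi1 : Integrable (fun x => deriv f (ρ t x) * ρt t x) (volume.restrict Ω) :=
    (hρt2.integrable one_le_two).bdd_mul hf'm (Eventually.of_forall fun x => hfC' _)
  have hi2 : Integrable (fun x => f (ρ t x) * divOf (Du t x)) (volume.restrict Ω) :=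
    (hDiv.integrable one_le_two).bdd_mul hfm (Eventually.of_forall fun x => hfC _)
  have hDu : Integrable (fun x => Dρ t x (u t x)) (volume.restrict Ω) := by
    refine (hDρ2.norm.integrable_mul hu2.norm).mono'
      ((isBoundedBilinearMap_apply (𝕜 := ℝ) (E := E3) (F := ℝ)).continuous.comp_aestronglyMeasurable
        (hDρ2.1.prodMk hu2.1)) (Eventually.of_forall fun x => (Dρ t x).le_opNorm _)
  have hi3 : Integrable (fun x => deriv f (ρ t x) * Dρ t x (u t x)) (volume.restrict Ω) :=
    hDu.bdd_mul hf'm (Eventually.of_forall fun x => hfC' _)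
  calc ∫ x in Ω, deriv f (ρ t x) * ρt t x
      = (∫ x in Ω, deriv f (ρ t x) * ρt t x)
        + ∫ x in Ω, (deriv f (ρ t x) * Dρ t x (u t x) + f (ρ t x) * divOf (Du t x)) := by
        have h0 : ∫ x in Ω, (deriv f (ρ t x) * Dρ t x (u t x)
          + f (ρ t x) * divOf (Du t x)) = 0 := hbc
        rw [h0, add_zero]
    _ = ∫ x in Ω, (deriv f (ρ t x) * ρt t x
        + (deriv f (ρ t x) * Dρ t x (u t x) + f (ρ t x) * divOf (Du t x))) :=
        (integral_add hi1 (hi3.add hi2)).symm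
    _ = _ := by
        refine integral_congr_ae ?_
        filter_upwards [hm] with x hx
        have : ρt t x = -(Dρ t x (u t x) + ρ t x * divOf (Du t x)) := by linarith
        rw [this]; ring

/-- Negative moments of the density propagate backwards in time: the constant `D` is a bound for
the norm of `div u` in `L¹(0,T; L^∞(Ω))`, and it depends on neither `ε` nor `p`. -/
theorem IsStrongSolutionWith.exists_integral_regInvPow_le
    (hΩ : IsSmoothSimplyConnectedDomain Ω) (hT : 0 < T)
    (h : IsStrongSolutionWith Ω γ mu lam T q ρ u Dρ ρt Du D2u ut Dut) :
    ∃ D : ℝ, ∀ (ε : ℝ), 0 < ε → ∀ p : ℕ,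
      ∫ x in Ω, regInvPow ε p (ρ 0 x)
        ≤ (∫ x in Ω, regInvPow ε p (ρ T x)) * Real.exp ((2 * p + 1) * D) := by
  obtain ⟨d, hdi, hdb⟩ := h.exists_divergence_bound hΩ
  refine ⟨∫ t in Ioo 0 T, d t, fun ε hε p => ?_⟩
  have hΩf : volume Ω ≠ ⊤ := hΩ.isBounded.measure_lt_top.ne
  have hfin : IsFiniteMeasure (volume.restrict Ω) := ⟨by simpa using hΩf.lt_top⟩
  have hΩ0 : volume Ω ≠ 0 := (hΩ.isOpen.measure_pos _ hΩ.isSimplyConnected.nonempty).ne'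
  have hq2 : (2 : ℝ≥0∞) ≤ ENNReal.ofReal q := by
    simpa using ENNReal.ofReal_le_ofReal (by linarith [h.q_gt] : (2 : ℝ) ≤ q)
  obtain ⟨R, R', hRc, hRc', hR, hR', hRd⟩ := exists_hasDerivAt_lp hΩ.isOpen hΩf hT.le
    (h.rho_C.mono_exponent hΩf two_ne_zero hq2) (h.rhot_C.mono_exponent hΩf two_ne_zero hq2)
    h.weakTimeDeriv_rho
  obtain ⟨C₁, hC₁⟩ := exists_bound_deriv_regInvPow hε p
  obtain ⟨L, hL⟩ := exists_lipschitzWith_deriv_regInvPow hε p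
  set f := regInvPow ε p with hf
  have hfs : ContDiff ℝ ∞ f := contDiff_regInvPow hε p
  have hfd : Differentiable ℝ f := hfs.differentiable (by simp)
  have h0 : deriv f 0 = 0 := deriv_regInvPow_zero hε p
  have hfpos : ∀ r, 0 < f r := regInvPow_pos hε p
  set C := max (ε ^ p)⁻¹ C₁ with hC
  have hfC : ∀ r, |f r| ≤ C := fun r => by
    rw [abs_of_pos (hfpos r)]
    exact (regInvPow_le hε p r).trans (le_max_left _ _)
  have hfC' : ∀ r, |deriv f r| ≤ C := fun r => (hC₁ r).trans (le_max_right _ _)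
  have hΦ := hasFDerivAt_integral_comp_lp (μ := volume.restrict Ω) hfd hfC hL h0
  set Φ : Lp ℝ 2 (volume.restrict Ω) → ℝ := fun r => ∫ x in Ω, f (r x) with hΦdef
  have hΦc : Continuous Φ := continuous_iff_continuousAt.2 fun r => (hΦ r).continuousAt
  have hfi : ∀ r : Lp ℝ 2 (volume.restrict Ω), Integrable (fun x => f (r x))
      (volume.restrict Ω) := fun s =>
    Integrable.of_bound (hfd.continuous.comp_aestronglyMeasurable (Lp.aestronglyMeasurable s)) C
      (Eventually.of_forall fun x => hfC _)
  have hΦpos : ∀ r, 0 < Φ r := fun r => by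
    rw [hΦdef]
    simp only
    rw [integral_pos_iff_support_of_nonneg (fun x => (hfpos _).le) (hfi r)]
    have : Function.support (fun x => f (r x)) = univ := by
      ext x; simp [(hfpos (r x)).ne']
    rw [this, Measure.restrict_apply_univ]
    exact pos_iff_ne_zero.2 hΩ0
  have hΦρ : ∀ t ∈ Icc 0 T, ∫ x in Ω, f (ρ t x) = Φ (R t) := fun t ht => by
    refine integral_congr_ae ?_
    filter_upwards [hR t ht] with x hx
    rw [hx]
  rw [hΦρ 0 (left_mem_Icc.2 hT.le), hΦρ T (right_mem_Icc.2 hT.le)]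
  refine gronwall_integral_le (y := fun t => Φ (R t))
    (y' := fun t => inner ℝ (hL.compLp h0 (R t)) (R' t)) hT.le (hΦc.comp hRc)
    (((hL.continuous_compLp h0).comp hRc).inner hRc') (fun t => hΦpos _)
    (fun t ht => (hΦ (R t)).comp_hasDerivAt t (hRd t ht)) hdi ?_
  filter_upwards [h.ae_integral_deriv_mul_eq hΩ (hfs.of_le (by exact_mod_cast le_top)) hfC hfC',
    hdb, ae_restrict_mem measurableSet_Ioo] with t ht1 ht2 ht
  have ht' := Ioo_subset_Icc_self ht
  have e1 : inner ℝ (hL.compLp h0 (R t)) (R' t) = ∫ x in Ω, deriv f (ρ t x) * ρt t x := by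
    rw [L2.inner_def]
    refine integral_congr_ae ?_
    filter_upwards [hL.coeFn_compLp h0 (R t), hR t ht', hR' t ht'] with x hx1 hx2 hx3
    rw [hx1, hx3, Function.comp_apply, hx2]
    simp [mul_comm]
  rw [e1, ht1]
  have e2 : (2 * p + 1) * d t * Φ (R t) = ∫ x in Ω, (2 * p + 1) * d t * f (R t x) := by
    rw [integral_const_mul]
  rw [e2, ← Real.norm_eq_abs]
  refine norm_integral_le_of_norm_le ((hfi (R t)).const_mul _) ?_
  filter_upwards [ht2, hR t ht'] with x hx hxR
  rw [hxR, norm_mul, Real.norm_eq_abs, Real.norm_eq_abs]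
  have h3 := abs_mul_deriv_regInvPow_le hε p (ρ t x)
  have h4 : |f (ρ t x) - ρ t x * deriv f (ρ t x)| ≤ (2 * p + 1) * f (ρ t x) := by
    refine (abs_sub _ _).trans ?_
    rw [abs_of_pos (hfpos _)]
    linarith
  calc _ ≤ ((2 * p + 1) * f (ρ t x)) * d t :=
        mul_le_mul h4 hx (abs_nonneg _) (mul_nonneg (by positivity) (hfpos _).le)
    _ = _ := by ring

/-- If the density is bounded below by a positive constant at time `T`, then so it is at time
`0`. -/
theorem IsStrongSolutionWith.exists_pos_le_initial
    (hΩ : IsSmoothSimplyConnectedDomain Ω) (hT : 0 < T)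
    (h : IsStrongSolutionWith Ω γ mu lam T q ρ u Dρ ρt Du D2u ut Dut) {c : ℝ} (hc : 0 < c)
    (hcT : ∀ᵐ x ∂(volume.restrict Ω), c ≤ ρ T x) :
    ∃ κ : ℝ, 0 < κ ∧ ∀ᵐ x ∂(volume.restrict Ω), κ ≤ ρ 0 x := by
  obtain ⟨D, hD⟩ := h.exists_integral_regInvPow_le hΩ hT
  have hΩf : volume Ω ≠ ⊤ := hΩ.isBounded.measure_lt_top.ne
  have hfin : IsFiniteMeasure (volume.restrict Ω) := ⟨by simpa using hΩf.lt_top⟩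
  -- The moments give the bound `c exp (-D)`; half of it leaves room for the choice `ε = κ ^ 2` and
  -- for a factor `2 ^ p` in `key`, which as `p → ∞` forces the set `S` to be null.
  set κ := c * Real.exp (-D) / 2 with hκ
  have hκ0 : 0 < κ := by positivity
  have hρ0m : AEStronglyMeasurable (ρ 0) (volume.restrict Ω) :=
    (h.rho_C.2.1 0 (left_mem_Icc.2 hT.le)).1
  have hρTm : AEStronglyMeasurable (ρ T) (volume.restrict Ω) :=
    (h.rho_C.2.1 T (right_mem_Icc.2 hT.le)).1
  set S := {x | |ρ 0 x| ≤ κ} with hS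
  set m := (volume.restrict Ω).real S with hm
  have hε : 0 < κ ^ 2 := by positivity
  have key : ∀ p : ℕ, m * 2 ^ p ≤ volume.real Ω * Real.exp D := by
    intro p
    have hpos := regInvPow_pos hε p
    have hfi : ∀ g : E3 → ℝ, AEStronglyMeasurable g (volume.restrict Ω) →
        Integrable (fun x => regInvPow (κ ^ 2) p (g x)) (volume.restrict Ω) := fun g hg =>
      Integrable.of_bound ((contDiff_regInvPow hε p).continuous.comp_aestronglyMeasurable hg)
        ((κ ^ 2) ^ p)⁻¹ (Eventually.of_forall fun x => by
          rw [Real.norm_of_nonneg (hpos _).le]; exact regInvPow_le hε p _)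
    have hT1 : ∫ x in Ω, regInvPow (κ ^ 2) p (ρ T x) ≤ ((c ^ 2) ^ p)⁻¹ * volume.real Ω := by
      calc _ ≤ ∫ _x in Ω, ((c ^ 2) ^ p)⁻¹ := by
            refine integral_mono_ae (hfi _ hρTm) (integrable_const _) ?_
            filter_upwards [hcT] with x hx
            simp only [regInvPow]
            gcongr
            nlinarith
        _ = _ := by simp [mul_comm]
    have h01 : ((2 * κ ^ 2) ^ p)⁻¹ * m ≤ ∫ x in Ω, regInvPow (κ ^ 2) p (ρ 0 x) := by
      refine le_trans ?_ (mul_meas_ge_le_integral_of_nonneg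
        (Eventually.of_forall fun x => (hpos _).le) (hfi _ hρ0m) ((2 * κ ^ 2) ^ p)⁻¹)
      refine mul_le_mul_of_nonneg_left (measureReal_mono ?_) (by positivity)
      intro x hx
      change ((2 * κ ^ 2) ^ p)⁻¹ ≤ ((ρ 0 x ^ 2 + κ ^ 2) ^ p)⁻¹
      gcongr
      have hx' : |ρ 0 x| ≤ κ := hx
      have := sq_le_sq' (by linarith [abs_nonneg (ρ 0 x)]) hx'
      rw [sq_abs] at this
      linarith
    have h2 := h01.trans ((hD _ hε p).trans (mul_le_mul_of_nonneg_right hT1 (Real.exp_pos _).le))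
    have h3 : (2 * κ ^ 2) ^ p * 2 ^ p = (c ^ 2) ^ p * Real.exp (-(2 * p * D)) := by
      rw [← mul_pow, hκ, show Real.exp (-(2 * p * D)) = (Real.exp (-D) ^ 2) ^ p by
        rw [← pow_mul, ← Real.exp_nat_mul]; congr 1; push_cast; ring, ← mul_pow]
      congr 1; ring
    calc m * 2 ^ p = ((2 * κ ^ 2) ^ p * 2 ^ p) * (((2 * κ ^ 2) ^ p)⁻¹ * m) := by field_simp
      _ ≤ ((2 * κ ^ 2) ^ p * 2 ^ p) *
          (((c ^ 2) ^ p)⁻¹ * volume.real Ω * Real.exp ((2 * p + 1) * D)) := by gcongr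
      _ = volume.real Ω * (Real.exp (-(2 * p * D)) * Real.exp ((2 * p + 1) * D)) := by
          rw [h3]; field_simp
      _ = volume.real Ω * Real.exp D := by
          rw [← Real.exp_add]; congr 2; ring
  have hm0 : m = 0 := by
    by_contra hne
    have hmpos : 0 < m := lt_of_le_of_ne measureReal_nonneg (Ne.symm hne)
    obtain ⟨p, hp⟩ := pow_unbounded_of_one_lt (volume.real Ω * Real.exp D / m) one_lt_two
    have := key p
    rw [div_lt_iff₀ hmpos] at hp
    linarith
  refine ⟨κ, hκ0, ?_⟩
  have hS0 : (volume.restrict Ω) S = 0 := by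
    rwa [hm, measureReal_eq_zero_iff] at hm0
  have hnS : ∀ᵐ x ∂(volume.restrict Ω), x ∉ S := measure_eq_zero_iff_ae_notMem.1 hS0
  filter_upwards [hnS, h.rho_nonneg 0 (left_mem_Icc.2 hT.le)] with x hx hx0
  have : ¬ |ρ 0 x| ≤ κ := hx
  rw [abs_of_nonneg hx0] at this
  exact (not_le.1 this).le

end

/-- The essential infimum of a real function is a supremum of a set of lower bounds, which is
bounded above because `μ ≠ 0`. -/
theorem essInf_eq_zero_iff {α : Type*} [MeasurableSpace α] {μ : Measure α} (hμ : μ ≠ 0)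
    {f : α → ℝ} (hf : ∀ᵐ x ∂μ, 0 ≤ f x) :
    essInf f μ = 0 ↔ ∀ c, 0 < c → ¬ ∀ᵐ x ∂μ, c ≤ f x := by
  have hne : (ae μ).NeBot := ae_neBot.2 hμ
  have hbdd : BddAbove {a | ∀ᵐ x ∂μ, a ≤ f x} := by
    by_contra hb
    rw [not_bddAbove_iff] at hb
    have h1 : ∀ n : ℕ, ∀ᵐ x ∂μ, (n : ℝ) ≤ f x := fun n => by
      obtain ⟨a, ha, hna⟩ := hb n
      have ha : ∀ᵐ x ∂μ, a ≤ f x := ha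
      filter_upwards [ha] with x hx using hna.le.trans hx
    obtain ⟨x, hx⟩ := (ae_all_iff.2 h1).exists
    obtain ⟨n, hn⟩ := exists_nat_gt (f x)
    exact absurd (hx n) (not_le.2 hn)
  have hes : essInf f μ = sSup {a | ∀ᵐ x ∂μ, a ≤ f x} := Filter.liminf_eq
  rw [hes]
  constructor
  · intro h c hc hcf
    exact absurd (le_csSup hbdd hcf) (by rw [h]; exact not_le.2 hc)
  · intro h
    refine le_antisymm (csSup_le ⟨0, hf⟩ fun a ha => ?_) (le_csSup hbdd hf)
    by_contra hpos
    exact h a (not_le.1 hpos) ha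

end CompressibleNS

end

theorem theorem1p2 (Ω : Set CompressibleNS.E3)
    (hΩ : CompressibleNS.IsSmoothSimplyConnectedDomain Ω)
    (γ mu lam : ℝ) (hγ : 1 < γ) (hmu : 0 < mu) (hlam : 0 ≤ 2 * mu + 3 * lam)
    (ρ₀ : CompressibleNS.E3 → ℝ) (u₀ : CompressibleNS.E3 → CompressibleNS.E3)
    (hdata : CompressibleNS.IsAdmissibleData Ω ρ₀ u₀)
    (ρ : ℝ → CompressibleNS.E3 → ℝ) (u : ℝ → CompressibleNS.E3 → CompressibleNS.E3)
    (hsol : CompressibleNS.IsGlobalStrongSolution Ω γ mu lam ρ₀ u₀ ρ u)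
    (ρhat : ℝ) (hρhat : 0 < ρhat)
    (hbound : ∀ t : ℝ, 0 ≤ t →
      eLpNorm (ρ t) ⊤ (volume.restrict Ω) ≤ ENNReal.ofReal ρhat)
    (hvac : essInf ρ₀ (volume.restrict Ω) = 0) :
    ∀ t : ℝ, 0 ≤ t → essInf (ρ t) (volume.restrict Ω) = 0 := by
  intro t ht
  rcases ht.eq_or_lt with rfl | htpos
  · exact (essInf_congr_ae hsol.initial_rho).trans hvac
  · obtain ⟨q, Dρ, ρt, Du, D2u, ut, Dut, h⟩ := hsol.strong t htpos
    have hΩne : Ω.Nonempty := hΩ.isSimplyConnected.nonempty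
    have hμ : volume.restrict Ω ≠ 0 := by
      rw [Ne, Measure.restrict_eq_zero]
      exact (hΩ.isOpen.measure_pos _ hΩne).ne'
    rw [CompressibleNS.essInf_eq_zero_iff hμ hdata.nonneg] at hvac
    rw [CompressibleNS.essInf_eq_zero_iff hμ (h.rho_nonneg t (right_mem_Icc.2 ht))]
    intro c hc hct
    obtain ⟨κ, hκ, hκ0⟩ := h.exists_pos_le_initial hΩ htpos hc hct
    refine hvac κ hκ ?_
    filter_upwards [hκ0, hsol.initial_rho] with x hx hx0
    rwa [← hx0]
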